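/- Let $d\ge 0$ be an integer and let $P\subseteq\mathbb{R}^d$ be a closed convex cone (containing $0$) that is spanning, $P-P=\mathbb{R}^d$, and pointed, $P\cap(-P)=\{0\}$. Inner products are antilinear in the first variable. For a complex Hilbert space $H$, an $E_0$-semigroup over $P$ on $B(H)$ is a family $\alpha=\{\alpha_x\}_{x\in P}$ of unital normal $*$-endomorphisms of $B(H)$ with $\alpha_0=\mathrm{id}$, $\alpha_x\circ\alpha_y=\alpha_{x+y}$ for $x,y\in P$, and $x\mapsto\rho(\alpha_x(T))$ continuous on $P$ for every $T\in B(H)$ and every $\rho$ in the predual of $B(H)$. It extends to an automorphism group if there is a family $\{\beta_x\}_{x\in\mathbb{R}^d}$ of $*$-automorphisms of $B(H)$ with $\beta_0=\mathrm{id}$, $\beta_{x+y}=\beta_x\circ\beta_y$ for all $x,y\in\mathbb{R}^d$, and $\beta_x=\alpha_x$ for all $x\in P$. For a unitary $U:H\to K$ write $\mathrm{Ad}(U)(T)=UTU^*$. An $\alpha$-cocycle is a strongly continuous family $\{W_x\}_{x\in P}$ of unitaries on $H$ with $W_x\alpha_x(W_y)=W_{x+y}$ for all $x,y\in P$. An $E_0$-semigroup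 $\alpha$ on $B(H)$ is cocycle conjugate to an $E_0$-semigroup $\beta$ on $B(K)$ if there are a unitary $U:H\to K$ and a $\beta$-cocycle $\{W_x\}_{x\in P}$ such that $\mathrm{Ad}(U)\circ\alpha_x\circ\mathrm{Ad}(U)^{-1}=\mathrm{Ad}(W_x)\circ\beta_x$ for all $x\in P$. This is an equivalence relation. Let $B_0(d)$ be the set of strictly upper triangular real $d\times d$ matrices. For $A\in B_0(d)$ and $x,y\in\mathbb{R}^d$ put $\omega_A(x,y)=e^{i\langle Ax,y\rangle}$, and for $x\in P$ let $U^A_x$ be the unitary operator on $L^2(\mathbb{R}^d)$ given by $$(U^A_xf)(y)=\omega_A(x,y-x)\,f(y-x)\qquad\text{for almost every }y\in\mathbb{R}^d .$$ Put $\alpha^A_x=\mathrm{Ad}(U^A_x)$. Then $\alpha^A=\{\alpha^A_x\}_{x\in P}$ is an $E_0$-semigroup over $P$ on $B(L^2(\mathbb{R}^d))$ that extends to an automorphism group. Let $\mathfrak{E}$ be the set of cocycle conjugacy classes of $E_0$-semigroups over $P$ on $B(L^2(\mathbb{R}^d))$ that extend to an automorphism group. Then the map $B_0(d)\ni A\mapsto[\alpha^A]\in\mathfrak{E}$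 is a bijection. -/

import Mathlib

open MeasureTheory Filter Topology
open scoped InnerProductSpace ENNReal

noncomputable section

namespace ConeE0

/-! ### E₀-semigroups on `B(H)` and cocycle conjugacy -/

section Abstract

variable {S : Type*} [AddCommMonoid S] [TopologicalSpace S]
variable {H : Type*} [NormedAddCommGroup H] [InnerProductSpace ℂ H] [CompleteSpace H]
variable {K : Type*} [NormedAddCommGroup K] [InnerProductSpace ℂ K] [CompleteSpace K]
variable {L : Type*} [NormedAddCommGroup L] [InnerProductSpace ℂ L] [CompleteSpace L]

/-- `ρ` belongs to the predual of `B(H)`: it is of the form `T ↦ ∑ₙ ⟪ξₙ, T ηₙ⟫` for two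
square-summable sequences of vectors (equivalently `T ↦ tr (R T)` with `R` of trace class). -/
def IsNormalFunctional (ρ : (H →L[ℂ] H) → ℂ) : Prop :=
  ∃ ξ η : ℕ → H, (Summable fun n => ‖ξ n‖ ^ 2) ∧ (Summable fun n => ‖η n‖ ^ 2) ∧
    ∀ T : H →L[ℂ] H, ρ T = ∑' n, ⟪ξ n, T (η n)⟫_ℂ

/-- A map `B(H) → B(H)` is normal (that is, `σ`-weakly continuous) if it pulls back elements of the
predual to elements of the predual. -/
def IsNormalMap (φ : (H →L[ℂ] H) → (H →L[ℂ] H)) : Prop :=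
  ∀ ρ : (H →L[ℂ] H) → ℂ, IsNormalFunctional ρ → IsNormalFunctional fun T => ρ (φ T)

variable (S H) in
/-- An `E₀`-semigroup over `S` on `B(H)`: a `σ`-weakly continuous semigroup of unital normal
`*`-endomorphisms of `B(H)` indexed by `S`. -/
structure E0Semigroup where
  /-- the endomorphism attached to an index -/
  toFun : S → ((H →L[ℂ] H) →⋆ₐ[ℂ] (H →L[ℂ] H))
  normal' : ∀ x, IsNormalMap (toFun x)
  map_zero' : toFun 0 = StarAlgHom.id ℂ (H →L[ℂ] H)
  map_add' : ∀ x y, toFun (x + y) = (toFun x).comp (toFun y)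
  continuous' : ∀ ρ : (H →L[ℂ] H) → ℂ, IsNormalFunctional ρ → ∀ T : H →L[ℂ] H,
    Continuous fun x => ρ (toFun x T)

/-- `W` is an `α`-cocycle: a strongly continuous family of unitaries with
`W x * α x (W y) = W (x + y)`. -/
structure IsCocycle (α : E0Semigroup S H) (W : S → unitary (H →L[ℂ] H)) : Prop where
  continuous : ∀ ξ : H, Continuous fun x => (W x : H →L[ℂ] H) ξ
  mul : ∀ x y, (W x : H →L[ℂ] H) * α.toFun x (W y : H →L[ℂ] H) = (W (x + y) : H →L[ℂ] H)

/-- `α` (on `B(H)`) is cocycle conjugate to `β` (on `B(K)`): for some unitary `U : H → K` the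
`E₀`-semigroup `Ad U ∘ αₓ ∘ (Ad U)⁻¹` is a cocycle perturbation `Ad (W x) ∘ βₓ` of `β`. -/
def CocycleConjugate (α : E0Semigroup S H) (β : E0Semigroup S K) : Prop :=
  ∃ (U : H ≃ₗᵢ[ℂ] K) (W : S → unitary (K →L[ℂ] K)), IsCocycle β W ∧
    ∀ (x : S) (T : K →L[ℂ] K),
      U.conjStarAlgEquiv (α.toFun x (U.conjStarAlgEquiv.symm T)) =
        Unitary.conjStarAlgAut ℂ (K →L[ℂ] K) (W x) (β.toFun x T)

/-- Applying a strongly continuous family of unitaries to a continuous family of vectors. -/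
theorem continuous_unitary_apply {X : Type*} [TopologicalSpace X]
    {W : X → unitary (H →L[ℂ] H)} (hW : ∀ ξ : H, Continuous fun x => (W x : H →L[ℂ] H) ξ)
    {g : X → H} (hg : Continuous g) : Continuous fun x => (W x : H →L[ℂ] H) (g x) := by
  rw [continuous_iff_continuousAt]
  intro x₀
  have h1 : Tendsto (fun x => (W x : H →L[ℂ] H) (g x₀)) (𝓝 x₀) (𝓝 ((W x₀ : H →L[ℂ] H) (g x₀))) :=
    (hW (g x₀)).tendsto x₀
  have h2 : Tendsto (fun x => (W x : H →L[ℂ] H) (g x - g x₀)) (𝓝 x₀) (𝓝 0) := by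
    rw [tendsto_zero_iff_norm_tendsto_zero]
    have h3 : Tendsto (fun x => ‖g x - g x₀‖) (𝓝 x₀) (𝓝 0) := by
      have := (hg.tendsto x₀).sub_const (g x₀)
      rw [sub_self] at this
      simpa using this.norm
    refine h3.congr fun x => ?_
    rw [ContinuousLinearMap.norm_map_of_mem_unitary (W x).2]
  have h4 := h1.add h2
  rw [add_zero] at h4
  refine h4.congr fun x => ?_
  rw [← map_add, add_sub_cancel]

theorem unitary_apply_star_apply (W : unitary (H →L[ℂ] H)) (ξ : H) :
    (W : H →L[ℂ] H) ((star (W : H →L[ℂ] H)) ξ) = ξ := by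
  have := Unitary.mul_star_self_of_mem W.2
  calc _ = ((W : H →L[ℂ] H) * star (W : H →L[ℂ] H)) ξ := rfl
    _ = ξ := by rw [this]; rfl

theorem unitary_star_apply_apply (W : unitary (H →L[ℂ] H)) (ξ : H) :
    (star (W : H →L[ℂ] H)) ((W : H →L[ℂ] H) ξ) = ξ := by
  have := Unitary.star_mul_self_of_mem W.2
  calc _ = (star (W : H →L[ℂ] H) * (W : H →L[ℂ] H)) ξ := rfl
    _ = ξ := by rw [this]; rfl

/-- The adjoints of a strongly continuous family of unitaries are strongly continuous. -/
theorem continuous_unitary_star {X : Type*} [TopologicalSpace X]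
    {W : X → unitary (H →L[ℂ] H)} (hW : ∀ ξ : H, Continuous fun x => (W x : H →L[ℂ] H) ξ)
    (ξ : H) : Continuous fun x => (star (W x : H →L[ℂ] H)) ξ := by
  rw [continuous_iff_continuousAt]
  intro x₀
  rw [ContinuousAt, tendsto_iff_norm_sub_tendsto_zero]
  set η := (star (W x₀ : H →L[ℂ] H)) ξ with hη
  have h1 : Tendsto (fun x => ‖(W x : H →L[ℂ] H) η - (W x₀ : H →L[ℂ] H) η‖) (𝓝 x₀) (𝓝 0) :=
    tendsto_iff_norm_sub_tendsto_zero.1 ((hW η).tendsto x₀)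
  refine h1.congr fun x => ?_
  have h2 : (W x₀ : H →L[ℂ] H) η = ξ := unitary_apply_star_apply _ _
  rw [h2, norm_sub_rev, ← ContinuousLinearMap.norm_map_of_mem_unitary (W x).2 (_ - η), map_sub,
    unitary_apply_star_apply]

/-- `Ad U` of a unitary, as an element of the unitary group. -/
def conjUnitary (U : H ≃ₗᵢ[ℂ] K) (W : unitary (H →L[ℂ] H)) : unitary (K →L[ℂ] K) :=
  ⟨U.conjStarAlgEquiv W, by
    rw [Unitary.mem_iff, ← map_star, ← map_mul, ← map_mul, Unitary.star_mul_self_of_mem W.2,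
      Unitary.mul_star_self_of_mem W.2, map_one]
    exact ⟨rfl, rfl⟩⟩

theorem coe_conjUnitary (U : H ≃ₗᵢ[ℂ] K) (W : unitary (H →L[ℂ] H)) :
    (conjUnitary U W : K →L[ℂ] K) = U.conjStarAlgEquiv (W : H →L[ℂ] H) := rfl

theorem CocycleConjugate.refl (α : E0Semigroup S H) : CocycleConjugate α α := by
  refine ⟨LinearIsometryEquiv.refl ℂ H, fun _ => 1, ⟨fun ξ => continuous_const, fun x y => ?_⟩,
    fun x T => ?_⟩
  · simp
  · simp

theorem CocycleConjugate.symm {α : E0Semigroup S H} {β : E0Semigroup S K}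
    (h : CocycleConjugate α β) : CocycleConjugate β α := by
  obtain ⟨U, W, hW, h⟩ := h
  have key : ∀ x (T : H →L[ℂ] H), U.conjStarAlgEquiv (α.toFun x T) =
      (W x : K →L[ℂ] K) * β.toFun x (U.conjStarAlgEquiv T) * star (W x : K →L[ℂ] K) := by
    intro x T
    have := h x (U.conjStarAlgEquiv T)
    rwa [StarAlgEquiv.symm_apply_apply, Unitary.conjStarAlgAut_apply] at this
  refine ⟨U.symm, fun x => conjUnitary U.symm (star (W x)), ⟨fun ξ => ?_, fun x y => ?_⟩,
    fun x T => ?_⟩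
  · have := U.symm.continuous.comp (continuous_unitary_star hW.continuous (U ξ))
    exact this
  · apply EquivLike.injective U.conjStarAlgEquiv
    rw [map_mul, key]
    simp only [coe_conjUnitary, ← LinearIsometryEquiv.symm_conjStarAlgEquiv,
      StarAlgEquiv.apply_symm_apply, Unitary.coe_star]
    rw [← hW.mul x y, star_mul, map_star, ← mul_assoc, ← mul_assoc,
      Unitary.star_mul_self_of_mem (W x).2, one_mul]
  · apply EquivLike.injective U.conjStarAlgEquiv
    rw [Unitary.conjStarAlgAut_apply, map_mul, map_mul, map_star, key]
    simp only [coe_conjUnitary, ← LinearIsometryEquiv.symm_conjStarAlgEquiv,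
      StarAlgEquiv.apply_symm_apply, Unitary.coe_star, star_star]
    rw [show U.conjStarAlgEquiv.symm.symm T = U.conjStarAlgEquiv T from rfl]
    simp only [mul_assoc]
    rw [Unitary.star_mul_self_of_mem (W x).2, mul_one, ← mul_assoc,
      Unitary.star_mul_self_of_mem (W x).2, one_mul]

theorem CocycleConjugate.trans {α : E0Semigroup S H} {β : E0Semigroup S K} {γ : E0Semigroup S L}
    (h₁ : CocycleConjugate α β) (h₂ : CocycleConjugate β γ) : CocycleConjugate α γ := by
  obtain ⟨U, W, hW, h₁⟩ := h₁
  obtain ⟨V, Z, hZ, h₂⟩ := h₂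
  have key : ∀ x (T : K →L[ℂ] K), V.conjStarAlgEquiv (β.toFun x T) =
      (Z x : L →L[ℂ] L) * γ.toFun x (V.conjStarAlgEquiv T) * star (Z x : L →L[ℂ] L) := by
    intro x T
    have := h₂ x (V.conjStarAlgEquiv T)
    rwa [StarAlgEquiv.symm_apply_apply, Unitary.conjStarAlgAut_apply] at this
  refine ⟨U.trans V, fun x => conjUnitary V (W x) * Z x, ⟨fun ξ => ?_, fun x y => ?_⟩,
    fun x T => ?_⟩
  · have h1 : Continuous fun x => V.symm ((Z x : L →L[ℂ] L) ξ) :=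
      V.symm.continuous.comp (hZ.continuous ξ)
    exact V.continuous.comp (continuous_unitary_apply hW.continuous h1)
  · simp only [Submonoid.coe_mul, coe_conjUnitary, map_mul]
    rw [← hW.mul x y, map_mul, key, ← hZ.mul x y]
    simp only [mul_assoc]
    rw [← mul_assoc (star (Z x : L →L[ℂ] L)), Unitary.star_mul_self_of_mem (Z x).2, one_mul]
  · rw [LinearIsometryEquiv.conjStarAlgEquiv_trans]
    have e1 := congrArg V.conjStarAlgEquiv (h₁ x (V.conjStarAlgEquiv.symm T))
    rw [Unitary.conjStarAlgAut_apply, map_mul, map_mul, map_star, key,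
      StarAlgEquiv.apply_symm_apply] at e1
    rw [Unitary.conjStarAlgAut_apply]
    simp only [Submonoid.coe_mul, coe_conjUnitary, star_mul, mul_assoc] at e1 ⊢
    exact e1

variable (S H) in
/-- Cocycle conjugacy as an equivalence relation on the `E₀`-semigroups on `B(H)`. -/
def cocycleSetoid : Setoid (E0Semigroup S H) where
  r := CocycleConjugate
  iseqv := ⟨CocycleConjugate.refl, CocycleConjugate.symm, CocycleConjugate.trans⟩

/-- The terms of a normal functional are summable. -/
theorem summable_mul_norm {H : Type*} [NormedAddCommGroup H] {ξ η : ℕ → H} (hξ : Summable fun n => ‖ξ n‖ ^ 2)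
    (hη : Summable fun n => ‖η n‖ ^ 2) : Summable fun n => ‖ξ n‖ * ‖η n‖ := by
  refine Summable.of_nonneg_of_le (fun n => by positivity) (fun n => ?_) (hξ.add hη)
  nlinarith [sq_nonneg (‖ξ n‖ - ‖η n‖), sq_nonneg (‖ξ n‖), sq_nonneg (‖η n‖)]

/-- Conjugation by a unitary is normal. -/
theorem isNormalMap_conj (W : unitary (H →L[ℂ] H)) :
    IsNormalMap (Unitary.conjStarAlgAut ℂ (H →L[ℂ] H) W) := by
  rintro ρ ⟨ξ, η, hξ, hη, hρ⟩
  have hn : ∀ v : H, ‖(star (W : H →L[ℂ] H)) v‖ = ‖v‖ := fun v =>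
    ContinuousLinearMap.norm_map_of_mem_unitary (star W).2 v
  refine ⟨fun n => (star (W : H →L[ℂ] H)) (ξ n), fun n => (star (W : H →L[ℂ] H)) (η n), ?_, ?_,
    fun T => ?_⟩
  · simpa only [hn] using hξ
  · simpa only [hn] using hη
  · refine (hρ _).trans ?_
    refine tsum_congr fun n => ?_
    rw [ContinuousLinearMap.star_eq_adjoint, ContinuousLinearMap.adjoint_inner_left]
    rfl

/-- Conjugation by a strongly continuous family of unitaries is `σ`-weakly continuous. -/
theorem continuous_conj {X : Type*} [TopologicalSpace X]
    {W : X → unitary (H →L[ℂ] H)} (hW : ∀ ξ : H, Continuous fun x => (W x : H →L[ℂ] H) ξ)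
    {ρ : (H →L[ℂ] H) → ℂ} (hρ : IsNormalFunctional ρ) (T : H →L[ℂ] H) :
    Continuous fun x => ρ (Unitary.conjStarAlgAut ℂ (H →L[ℂ] H) (W x) T) := by
  obtain ⟨ξ, η, hξ, hη, hρ⟩ := hρ
  have hn : ∀ x (v : H), ‖(star (W x : H →L[ℂ] H)) v‖ = ‖v‖ := fun x v =>
    ContinuousLinearMap.norm_map_of_mem_unitary (star (W x)).2 v
  simp only [hρ]
  refine continuous_tsum (u := fun n => ‖T‖ * (‖ξ n‖ * ‖η n‖)) (fun n => ?_)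
    ((summable_mul_norm hξ hη).mul_left _) (fun n x => ?_)
  · exact continuous_const.inner (continuous_unitary_apply hW
      (T.continuous.comp (continuous_unitary_star hW (η n))))
  · refine (norm_inner_le_norm _ _).trans ?_
    have h1 : ‖(Unitary.conjStarAlgAut ℂ (H →L[ℂ] H) (W x) T) (η n)‖ ≤ ‖T‖ * ‖η n‖ := by
      calc _ = ‖(W x : H →L[ℂ] H) (T ((star (W x : H →L[ℂ] H)) (η n)))‖ := rfl
        _ = ‖T ((star (W x : H →L[ℂ] H)) (η n))‖ :=
          ContinuousLinearMap.norm_map_of_mem_unitary (W x).2 _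
        _ ≤ ‖T‖ * ‖(star (W x : H →L[ℂ] H)) (η n)‖ := T.le_opNorm _
        _ = _ := by rw [hn]
    calc _ ≤ ‖ξ n‖ * (‖T‖ * ‖η n‖) := by gcongr
      _ = _ := by ring

end Abstract

/-! ### Twisted translations on `L²(ℝᵈ)` -/

/-- `d`-dimensional Euclidean space. -/
abbrev E (d : ℕ) : Type := EuclideanSpace ℝ (Fin d)

/-- The Hilbert space `L²(ℝᵈ)` of complex-valued functions, for Lebesgue measure. -/
abbrev L2 (d : ℕ) : Type := Lp ℂ 2 (volume : Measure (E d))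

/-- The real `d × d` matrices that are strictly upper triangular. -/
def StrictUpper (d : ℕ) : Type :=
  {A : Matrix (Fin d) (Fin d) ℝ // ∀ i j, j ≤ i → A i j = 0}

variable {d : ℕ}

/-- The multiplier `ω_A(x, y) = exp(i⟨Ax, y⟩)`. -/
def omega (A : StrictUpper d) (x y : E d) : ℂ :=
  Complex.exp (Complex.I * ((⟪Matrix.toEuclideanLin A.1 x, y⟫_ℝ : ℝ) : ℂ))

theorem norm_omega (A : StrictUpper d) (x y : E d) : ‖omega A x y‖ = 1 := by
  rw [omega, mul_comm, Complex.norm_exp_ofReal_mul_I]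

theorem omega_zero_left (A : StrictUpper d) (y : E d) : omega A 0 y = 1 := by
  simp [omega]

theorem omega_add_left (A : StrictUpper d) (x x' y : E d) :
    omega A (x + x') y = omega A x y * omega A x' y := by
  rw [omega, omega, omega, ← Complex.exp_add, map_add, inner_add_left]
  push_cast
  ring_nf

theorem omega_add_right (A : StrictUpper d) (x y y' : E d) :
    omega A x (y + y') = omega A x y * omega A x y' := by
  rw [omega, omega, omega, ← Complex.exp_add, inner_add_right]
  push_cast
  ring_nf

theorem continuous_omega (A : StrictUpper d) {X : Type*} [TopologicalSpace X] {f g : X → E d}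
    (hf : Continuous f) (hg : Continuous g) : Continuous fun p => omega A (f p) (g p) := by
  have h1 : Continuous fun p => Matrix.toEuclideanLin A.1 (f p) :=
    (LinearMap.continuous_of_finiteDimensional (Matrix.toEuclideanLin A.1)).comp hf
  have h2 : Continuous fun p => ⟪Matrix.toEuclideanLin A.1 (f p), g p⟫_ℝ := h1.inner hg
  exact Complex.continuous_exp.comp (continuous_const.mul (Complex.continuous_ofReal.comp h2))

theorem continuous_omega_sub (A : StrictUpper d) (x : E d) :
    Continuous fun y : E d => omega A x (y - x) :=
  continuous_omega A continuous_const (continuous_id.sub continuous_const)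

theorem memLp_mulUnimod {c : E d → ℂ} (hc : Continuous c) (h1 : ∀ y, ‖c y‖ = 1) (f : L2 d) :
    MemLp (fun y => c y * f y) 2 (volume : Measure (E d)) :=
  MemLp.of_le (Lp.memLp f) (hc.aestronglyMeasurable.mul (Lp.aestronglyMeasurable f))
    (ae_of_all _ fun y => by
      rw [norm_mul, h1, one_mul])

/-- Multiplication of an `L²` function by a continuous function of modulus one. -/
def mulUnimod (c : E d → ℂ) (hc : Continuous c) (h1 : ∀ y, ‖c y‖ = 1) : L2 d →ₗᵢ[ℂ] L2 d where
  toFun f := (memLp_mulUnimod hc h1 f).toLp _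
  map_add' f g := by
    apply Lp.ext
    filter_upwards [Lp.coeFn_add f g, (memLp_mulUnimod hc h1 f).coeFn_toLp,
      (memLp_mulUnimod hc h1 g).coeFn_toLp, (memLp_mulUnimod hc h1 (f + g)).coeFn_toLp,
      Lp.coeFn_add ((memLp_mulUnimod hc h1 f).toLp _) ((memLp_mulUnimod hc h1 g).toLp _)]
      with y e1 e2 e3 e4 e5
    rw [e4, e5, Pi.add_apply, e2, e3, e1, Pi.add_apply, mul_add]
  map_smul' a f := by
    apply Lp.ext
    filter_upwards [Lp.coeFn_smul a f, (memLp_mulUnimod hc h1 f).coeFn_toLp,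
      (memLp_mulUnimod hc h1 (a • f)).coeFn_toLp,
      Lp.coeFn_smul a ((memLp_mulUnimod hc h1 f).toLp _)] with y e1 e2 e3 e4
    rw [e3, RingHom.id_apply, e4, Pi.smul_apply, e2, e1, Pi.smul_apply, smul_eq_mul, smul_eq_mul]
    ring
  norm_map' f := by
    refine le_antisymm (Lp.norm_le_norm_of_ae_le ?_) (Lp.norm_le_norm_of_ae_le ?_)
    all_goals
      filter_upwards [(memLp_mulUnimod hc h1 f).coeFn_toLp] with y e
      simp only [LinearMap.coe_mk, AddHom.coe_mk]
      rw [e, norm_mul, h1, one_mul]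

theorem mulUnimod_coeFn (c : E d → ℂ) (hc : Continuous c) (h1 : ∀ y, ‖c y‖ = 1) (f : L2 d) :
    mulUnimod c hc h1 f =ᵐ[volume] fun y => c y * f y :=
  (memLp_mulUnimod hc h1 f).coeFn_toLp

/-- The translate `y ↦ f (y - x)`. -/
def translate (x : E d) : L2 d →ₗᵢ[ℂ] L2 d :=
  Lp.compMeasurePreservingₗᵢ ℂ (fun y => y - x) (measurePreserving_sub_right volume x)

theorem translate_coeFn (x : E d) (f : L2 d) :
    translate x f =ᵐ[volume] fun y => f (y - x) :=
  Lp.coeFn_compMeasurePreserving f (measurePreserving_sub_right volume x)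

/-- The twisted translation `(U f)(y) = ω_A(x, y - x) f (y - x)`, as an isometry. -/
def twistedIsometry (A : StrictUpper d) (x : E d) : L2 d →ₗᵢ[ℂ] L2 d :=
  (mulUnimod (fun y => omega A x (y - x))
    (continuous_omega_sub A x)
    (fun _ => norm_omega A _ _)).comp (translate x)

theorem twistedIsometry_coeFn (A : StrictUpper d) (x : E d) (f : L2 d) :
    twistedIsometry A x f =ᵐ[volume] fun y => omega A x (y - x) * f (y - x) := by
  filter_upwards [mulUnimod_coeFn (fun y => omega A x (y - x))
    (continuous_omega_sub A x)
    (fun _ => norm_omega A _ _) (translate x f), translate_coeFn x f] with y e1 e2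
  exact e1.trans (by rw [e2])

theorem twistedIsometry_comp (A : StrictUpper d) (x x' : E d) (f : L2 d) :
    twistedIsometry A x (twistedIsometry A x' f) =
      omega A x x' • twistedIsometry A (x + x') f := by
  apply Lp.ext
  have h := (measurePreserving_sub_right (volume : Measure (E d)) x).quasiMeasurePreserving.ae
    (twistedIsometry_coeFn A x' f)
  filter_upwards [twistedIsometry_coeFn A x (twistedIsometry A x' f), h,
    twistedIsometry_coeFn A (x + x') f,
    Lp.coeFn_smul (omega A x x') (twistedIsometry A (x + x') f)] with y e1 e2 e3 e4
  rw [e1, e2, e4, Pi.smul_apply, e3, smul_eq_mul, omega_add_left, sub_sub]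
  have : y - x = x' + (y - (x + x')) := by abel
  rw [this, omega_add_right]
  ring

theorem twistedIsometry_zero (A : StrictUpper d) (f : L2 d) : twistedIsometry A 0 f = f := by
  apply Lp.ext
  filter_upwards [twistedIsometry_coeFn A 0 f] with y e
  rw [e, omega_zero_left, one_mul, sub_zero]

theorem twistedIsometry_surjective (A : StrictUpper d) (x : E d) :
    Function.Surjective (twistedIsometry A x) := by
  intro f
  have hne : omega A x (-x) ≠ 0 := by
    rw [← norm_pos_iff, norm_omega]; exact one_pos
  refine ⟨(omega A x (-x))⁻¹ • twistedIsometry A (-x) f, ?_⟩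
  rw [map_smul, twistedIsometry_comp, add_neg_cancel, twistedIsometry_zero, smul_smul,
    inv_mul_cancel₀ hne, one_smul]

/-- The unitary `U^A_x` on `L²(ℝᵈ)`, `(U^A_x f)(y) = ω_A(x, y - x) f (y - x)`. -/
def twistedTranslation (A : StrictUpper d) (x : E d) : unitary (L2 d →L[ℂ] L2 d) :=
  Unitary.linearIsometryEquiv.symm
    (LinearIsometryEquiv.ofSurjective (twistedIsometry A x) (twistedIsometry_surjective A x))

theorem twistedTranslation_apply (A : StrictUpper d) (x : E d) (f : L2 d) :
    (twistedTranslation A x : L2 d →L[ℂ] L2 d) f = twistedIsometry A x f := rfl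

/-- The defining formula `(U^A_x f)(y) = ω_A(x, y - x) f (y - x)` for almost every `y`. -/
theorem twistedTranslation_coeFn (A : StrictUpper d) (x : E d) (f : L2 d) :
    (twistedTranslation A x : L2 d →L[ℂ] L2 d) f =ᵐ[volume]
      fun y => omega A x (y - x) * f (y - x) :=
  twistedIsometry_coeFn A x f

theorem twistedTranslation_mul (A : StrictUpper d) (x y : E d) :
    (twistedTranslation A x : L2 d →L[ℂ] L2 d) * (twistedTranslation A y : L2 d →L[ℂ] L2 d) =
      omega A x y • (twistedTranslation A (x + y) : L2 d →L[ℂ] L2 d) :=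
  ContinuousLinearMap.ext fun f => twistedIsometry_comp A x y f

theorem twistedTranslation_zero (A : StrictUpper d) : twistedTranslation A 0 = 1 :=
  Subtype.ext (ContinuousLinearMap.ext fun f => twistedIsometry_zero A f)

theorem continuous_translate (f : L2 d) : Continuous fun x : E d => translate x f :=
  Continuous.compMeasurePreservingLp (f := fun _ : E d => f)
    (g := fun x : E d => (⟨fun y => y - x, by fun_prop⟩ : C(E d, E d))) continuous_const
    (ContinuousMap.continuous_of_continuous_uncurry _ (by
      simp only [Function.uncurry_def, ContinuousMap.coe_mk]; fun_prop))
    (fun x => measurePreserving_sub_right volume x) (by simp)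

theorem continuous_twistedTranslation (A : StrictUpper d) (f : L2 d) :
    Continuous fun x : E d => (twistedTranslation A x : L2 d →L[ℂ] L2 d) f := by
  have hc : ∀ x : E d, Continuous fun y : E d => omega A x (y - x) := continuous_omega_sub A
  let M : E d → L2 d →ₗᵢ[ℂ] L2 d := fun x =>
    mulUnimod (fun y => omega A x (y - x)) (hc x) (fun _ => norm_omega A _ _)
  rw [continuous_iff_continuousAt]
  intro x₀
  set g : L2 d := translate x₀ f with hg
  have hin : ∀ x, ⟪M x₀ g, M x g⟫_ℂ =
      ∫ y, ⟪omega A x₀ (y - x₀) * g y, omega A x (y - x) * g y⟫_ℂ := by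
    intro x
    rw [L2.inner_def]
    refine integral_congr_ae ?_
    filter_upwards [mulUnimod_coeFn (fun y => omega A x (y - x)) (hc x)
      (fun _ => norm_omega A _ _) g, mulUnimod_coeFn (fun y => omega A x₀ (y - x₀)) (hc x₀)
      (fun _ => norm_omega A _ _) g] with y e1 e2
    rw [e1, e2]
  have hcont : Continuous fun x => ⟪M x₀ g, M x g⟫_ℂ := by
    simp only [hin]
    refine continuous_of_dominated (bound := fun y => ‖g y‖ ^ 2) (fun x => ?_) (fun x => ?_) ?_ ?_
    · exact ((hc x₀).aestronglyMeasurable.mul (Lp.aestronglyMeasurable g)).inner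
        ((hc x).aestronglyMeasurable.mul (Lp.aestronglyMeasurable g))
    · refine ae_of_all _ fun y => (norm_inner_le_norm _ _).trans ?_
      rw [norm_mul, norm_mul, norm_omega, norm_omega, one_mul, sq]
    · exact (memLp_two_iff_integrable_sq_norm (Lp.aestronglyMeasurable g)).1 (Lp.memLp g)
    · refine ae_of_all _ fun y => continuous_const.inner (Continuous.mul ?_ continuous_const)
      exact continuous_omega A continuous_id (continuous_const.sub continuous_id)
  have hsq : ∀ x, ‖M x g - M x₀ g‖ ^ 2 = 2 * ‖g‖ ^ 2 - 2 * (⟪M x₀ g, M x g⟫_ℂ).re := by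
    intro x
    rw [norm_sub_sq (𝕜 := ℂ), ← inner_conj_symm, (M x).norm_map, (M x₀).norm_map]
    simp only [RCLike.re_to_complex, Complex.conj_re]
    ring
  have h1 : Tendsto (fun x => ‖M x g - M x₀ g‖) (𝓝 x₀) (𝓝 0) := by
    have h2 : Continuous fun x => ‖M x g - M x₀ g‖ ^ 2 := by
      simp only [hsq]
      fun_prop
    have h3 : Continuous fun x => ‖M x g - M x₀ g‖ := by
      have := h2.sqrt
      simpa only [Real.sqrt_sq (norm_nonneg _)] using this
    simpa using h3.tendsto x₀
  have h4 : Tendsto (fun x => ‖translate x f - g‖) (𝓝 x₀) (𝓝 0) :=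
    tendsto_iff_norm_sub_tendsto_zero.1 ((continuous_translate f).tendsto x₀)
  rw [ContinuousAt, tendsto_iff_norm_sub_tendsto_zero]
  refine squeeze_zero (fun _ => norm_nonneg _) (fun x => ?_) (by simpa using h4.add h1)
  calc ‖(twistedTranslation A x : L2 d →L[ℂ] L2 d) f - (twistedTranslation A x₀ : L2 d →L[ℂ] L2 d) f‖
      = ‖M x (translate x f - g) + (M x g - M x₀ g)‖ := by
        rw [map_sub, sub_add_sub_cancel]; rfl
    _ ≤ ‖translate x f - g‖ + ‖M x g - M x₀ g‖ := by
        refine (norm_add_le _ _).trans ?_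
        rw [LinearIsometry.norm_map]

/-- The automorphism group `x ↦ Ad (U^A_x)` of `B(L²(ℝᵈ))`, indexed by `ℝᵈ`. -/
def twistedAut (A : StrictUpper d) (x : E d) : (L2 d →L[ℂ] L2 d) ≃⋆ₐ[ℂ] (L2 d →L[ℂ] L2 d) :=
  Unitary.conjStarAlgAut ℂ (L2 d →L[ℂ] L2 d) (twistedTranslation A x)

theorem twistedAut_zero (A : StrictUpper d) (T : L2 d →L[ℂ] L2 d) : twistedAut A 0 T = T := by
  rw [twistedAut, twistedTranslation_zero, map_one]; rfl

theorem twistedAut_add (A : StrictUpper d) (x y : E d) (T : L2 d →L[ℂ] L2 d) :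
    twistedAut A (x + y) T = twistedAut A x (twistedAut A y T) := by
  have h := twistedTranslation_mul A x y
  have hw : omega A x y * star (omega A x y) = 1 := by
    rw [Complex.star_def, Complex.mul_conj, Complex.normSq_eq_norm_sq, norm_omega]; simp
  simp only [twistedAut, Unitary.conjStarAlgAut_apply]
  calc _ = (omega A x y • (twistedTranslation A (x + y) : L2 d →L[ℂ] L2 d)) * T *
        star (omega A x y • (twistedTranslation A (x + y) : L2 d →L[ℂ] L2 d)) := by
        rw [star_smul, smul_mul_assoc, smul_mul_assoc, mul_smul_comm, smul_smul, hw, one_smul]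
    _ = _ := by
        rw [← h, star_mul]
        simp only [mul_assoc]

/-! ### Semigroups over a cone, and the classification map -/

/-- The `E₀`-semigroup `α^A = (Ad (U^A_x))_{x ∈ P}` on `B(L²(ℝᵈ))` over the cone `P`. -/
def twistedE0 (P : PointedCone ℝ (E d)) (A : StrictUpper d) : E0Semigroup P (L2 d) where
  toFun x := (twistedAut A (x : E d) : (L2 d →L[ℂ] L2 d) →⋆ₐ[ℂ] (L2 d →L[ℂ] L2 d))
  normal' x := isNormalMap_conj (twistedTranslation A (x : E d))
  map_zero' := StarAlgHom.ext fun T => twistedAut_zero A T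
  map_add' x y := StarAlgHom.ext fun T => twistedAut_add A x y T
  continuous' _ hρ T := continuous_conj (W := fun x : P => twistedTranslation A (x : E d))
    (fun f => (continuous_twistedTranslation A f).comp continuous_subtype_val) hρ T

/-- `α` extends to an automorphism group, that is, to a homomorphism from the additive group `ℝᵈ`
to the group of `*`-automorphisms of `B(H)`. For a cone `P` that spans `ℝᵈ` the extension is unique,
and it inherits `σ`-weak continuity from `α`, so that requiring continuity of it would not change
the notion. -/
def ExtendsToAutGroup {P : PointedCone ℝ (E d)} {H : Type*} [NormedAddCommGroup H]
    [InnerProductSpace ℂ H] [CompleteSpace H] (α : E0Semigroup P H) : Prop :=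
  ∃ β : E d → ((H →L[ℂ] H) ≃⋆ₐ[ℂ] (H →L[ℂ] H)),
    (∀ T, β 0 T = T) ∧ (∀ x y T, β (x + y) T = β x (β y T)) ∧
      ∀ (x : P) (T : H →L[ℂ] H), α.toFun x T = β (x : E d) T

theorem twistedE0_extends (P : PointedCone ℝ (E d)) (A : StrictUpper d) :
    ExtendsToAutGroup (twistedE0 P A) :=
  ⟨twistedAut A, twistedAut_zero A, twistedAut_add A, fun _ _ => rfl⟩

/-- The `E₀`-semigroups over `P` on `B(L²(ℝᵈ))` that extend to an automorphism group. -/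
abbrev ExtendableE0 (P : PointedCone ℝ (E d)) : Type :=
  {α : E0Semigroup P (L2 d) // ExtendsToAutGroup α}

/-- Cocycle conjugacy on the extendable `E₀`-semigroups. -/
def extendableSetoid (P : PointedCone ℝ (E d)) : Setoid (ExtendableE0 P) :=
  (cocycleSetoid P (L2 d)).comap Subtype.val

/-- The set of cocycle conjugacy classes of extendable `E₀`-semigroups on `B(L²(ℝᵈ))`. -/
def ExtendableClasses (P : PointedCone ℝ (E d)) : Type := Quotient (extendableSetoid P)

/-- The class `[α^A]`. -/
def twistedClass (P : PointedCone ℝ (E d)) (A : StrictUpper d) : ExtendableClasses P :=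
  Quotient.mk (extendableSetoid P) ⟨twistedE0 P A, twistedE0_extends P A⟩

end ConeE0

end

/-!
Every automorphism of `B(H)` is `Ad u` for a unitary `u` that is unique up to a phase. Over a line,
the phases of the implementing unitaries can be chosen so as to obtain a strongly continuous
one-parameter group, because continuous circle-valued 2-cocycles on `ℝ` lift to real ones and these
are coboundaries. The one-parameter groups of two commuting automorphism groups commute up to a
continuous bicharacter, which is the exponential `exp (i B)` of a real bilinear form. Multiplying
the one-parameter groups along a basis contained in the cone thus implements an automorphism group
of `ℝᵈ` by a projective representation with multiplier `exp (i B)`.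

A cocycle conjugacy is the same as a pair of implementing projective representations with the same
multiplier. Rephasing by `exp (i S(x, x) / 2)` removes a symmetric form `S` from `B`, whereas the
antisymmetric part of `B` is visible in the commutation relations over the cone. Finally, each
antisymmetric form is the antisymmetrization of `⟪A x, y⟫` for exactly one strictly upper triangular
matrix `A`.
-/

noncomputable section

namespace ConeE0

local notation "𝓤(" H ")" => unitary (H →L[ℂ] H)
local notation "Aut(" H ")" => (H →L[ℂ] H) ≃⋆ₐ[ℂ] (H →L[ℂ] H)
local notation "Ad" => Unitary.conjStarAlgAut ℂ _

section Phase

variable {H : Type*} [NormedAddCommGroup H] [InnerProductSpace ℂ H] [CompleteSpace H]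

instance : SMul Circle 𝓤(H) where
  smul c u := ⟨(c : ℂ) • (u : H →L[ℂ] H), Unitary.smul_mem_of_mem
    (Unitary.mem_iff_self_mul_star.2 (by simp [Complex.mul_conj])) u.2⟩

theorem coe_circle_smul (c : Circle) (u : 𝓤(H)) :
    ((c • u : 𝓤(H)) : H →L[ℂ] H) = c • (u : H →L[ℂ] H) :=
  rfl

instance : MulAction Circle 𝓤(H) :=
  Subtype.val_injective.mulAction _ coe_circle_smul

instance : IsScalarTower Circle 𝓤(H) 𝓤(H) where
  smul_assoc c u v := Subtype.ext (smul_mul_assoc (c : ℂ) (u : H →L[ℂ] H) (v : H →L[ℂ] H))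

instance : SMulCommClass Circle 𝓤(H) 𝓤(H) where
  smul_comm c u v := Subtype.ext (mul_smul_comm (c : ℂ) (u : H →L[ℂ] H) (v : H →L[ℂ] H)).symm

theorem conjStarAlgAut_circle_smul (c : Circle) (u : 𝓤(H)) : Ad (c • u) = Ad u := by
  ext1 T
  have hc : star (c : ℂ) * (c : ℂ) = 1 := by simp [mul_comm, Complex.mul_conj]
  simp only [Unitary.conjStarAlgAut_apply, coe_circle_smul, Circle.smul_def, star_smul,
    smul_mul_assoc, mul_smul_comm, smul_smul, hc, one_smul]

theorem circle_smul_apply (c : Circle) (u : 𝓤(H)) (ξ : H) :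
    ((c • u : 𝓤(H)) : H →L[ℂ] H) ξ = c • (u : H →L[ℂ] H) ξ :=
  rfl

theorem circle_smul_left_injective [Nontrivial H] (u : 𝓤(H)) :
    Function.Injective fun c : Circle => c • u := by
  intro c c' h
  obtain ⟨ξ, hξ⟩ := exists_ne (0 : H)
  have huξ : (u : H →L[ℂ] H) ξ ≠ 0 := by
    rwa [← norm_ne_zero_iff, Unitary.norm_map, norm_ne_zero_iff]
  have hsmul : (c : ℂ) • (u : H →L[ℂ] H) ξ = (c' : ℂ) • (u : H →L[ℂ] H) ξ :=
    congrArg (fun v : 𝓤(H) => (v : H →L[ℂ] H) ξ) h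
  exact Circle.ext (smul_left_injective ℂ huξ hsmul)

theorem exists_circle_smul_of_conjStarAlgAut_eq {u v : 𝓤(H)} (h : Ad u = Ad v) :
    ∃ c : Circle, u = c • v := by
  obtain ⟨c, hc⟩ := (Unitary.conjStarAlgAut_ext_iff' u v).1 h
  exact ⟨⟨c, mem_sphere_zero_iff_norm.2 (CStarRing.norm_coe_unitary c)⟩, hc⟩

theorem exists_unitary_conjStarAlgAut_eq (β : Aut(H)) : ∃ u : 𝓤(H), Ad u = β := by
  obtain ⟨U, hU⟩ := StarAlgEquiv.eq_linearIsometryEquivConjStarAlgEquiv β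
    (map_continuous β)
  exact ⟨Unitary.linearIsometryEquiv.symm U, by
    rw [Unitary.conjStarAlgAut_symm_unitaryLinearIsometryEquiv, hU]⟩

end Phase

section StrongContinuity

variable {X Y : Type*} [TopologicalSpace X] [TopologicalSpace Y]
variable {H : Type*} [NormedAddCommGroup H] [InnerProductSpace ℂ H] [CompleteSpace H]
variable {K : Type*} [NormedAddCommGroup K] [InnerProductSpace ℂ K] [CompleteSpace K]

/-- Continuity of a family of unitaries for the strong operator topology. -/
def StrongContinuous (V : X → 𝓤(H)) : Prop :=
  ∀ ξ : H, Continuous fun x => (V x : H →L[ℂ] H) ξ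

/-- Continuity of a family of automorphisms of `B(H)` for the pointwise weak operator topology. -/
def WeakContinuous (β : X → Aut(H)) : Prop :=
  ∀ (T : H →L[ℂ] H) (ξ η : H), Continuous fun x => ⟪ξ, β x T η⟫_ℂ

theorem StrongContinuous.comp {V : X → 𝓤(H)} (hV : StrongContinuous V) {f : Y → X}
    (hf : Continuous f) : StrongContinuous fun y => V (f y) :=
  fun ξ => (hV ξ).comp hf

theorem StrongContinuous.mul {V W : X → 𝓤(H)} (hV : StrongContinuous V)
    (hW : StrongContinuous W) : StrongContinuous fun x => V x * W x :=
  fun ξ => continuous_unitary_apply hV (hW ξ)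

theorem StrongContinuous.inv {V : X → 𝓤(H)} (hV : StrongContinuous V) :
    StrongContinuous fun x => (V x)⁻¹ :=
  continuous_unitary_star hV

theorem StrongContinuous.circle_smul {V : X → 𝓤(H)} (hV : StrongContinuous V) {c : X → Circle}
    (hc : Continuous c) : StrongContinuous fun x => c x • V x :=
  fun ξ => hc.smul (hV ξ)

theorem StrongContinuous.conjUnitary {V : X → 𝓤(H)} (hV : StrongContinuous V) (U : H ≃ₗᵢ[ℂ] K) :
    StrongContinuous fun x => conjUnitary U (V x) :=
  fun ξ => U.continuous.comp (hV (U.symm ξ))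

theorem StrongContinuous.continuous_phase [Nontrivial H] {V W : X → 𝓤(H)}
    (hV : StrongContinuous V) (hW : StrongContinuous W) {c : X → Circle}
    (h : ∀ x, V x = c x • W x) : Continuous c := by
  obtain ⟨ξ, hξ⟩ := exists_norm_eq H zero_le_one
  suffices Continuous fun x => (c x : ℂ) from
    Topology.IsInducing.subtypeVal.continuous_iff.2 this
  refine ((hW ξ).inner (𝕜 := ℂ) (hV ξ)).congr fun x => ?_
  rw [h, circle_smul_apply, Circle.smul_def, inner_smul_right, inner_self_eq_norm_sq_to_K,
    Unitary.norm_map, hξ]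
  simp

theorem strongContinuous_of_continuous_inner {V : X → 𝓤(H)}
    (hV : ∀ ξ η : H, Continuous fun x => ⟪ξ, (V x : H →L[ℂ] H) η⟫_ℂ) : StrongContinuous V := by
  refine fun η => continuous_iff_continuousAt.2 fun x₀ => tendsto_iff_norm_sub_tendsto_zero.2 ?_
  have norm_sub (x) : ‖(V x : H →L[ℂ] H) η - (V x₀ : H →L[ℂ] H) η‖ =
      √(2 * ‖η‖ ^ 2 - 2 * (⟪(V x₀ : H →L[ℂ] H) η, (V x : H →L[ℂ] H) η⟫_ℂ).re) := by
    rw [← Real.sqrt_sq (norm_nonneg _), norm_sub_sq (𝕜 := ℂ), ← inner_conj_symm,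
      Unitary.norm_map, Unitary.norm_map, RCLike.re_to_complex, Complex.conj_re]
    ring_nf
  have hcont : Continuous fun x =>
      √(2 * ‖η‖ ^ 2 - 2 * (⟪(V x₀ : H →L[ℂ] H) η, (V x : H →L[ℂ] H) η⟫_ℂ).re) := by
    have := hV ((V x₀ : H →L[ℂ] H) η) η
    fun_prop
  simpa only [← norm_sub, sub_self, norm_zero] using hcont.tendsto x₀

end StrongContinuity

section ImplementingUnitaries

variable {H : Type*} [NormedAddCommGroup H] [InnerProductSpace ℂ H] [CompleteSpace H]

theorem conjStarAlgAut_rankOne_apply (u : 𝓤(H)) (ξ η ζ : H) :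
    Ad u (InnerProductSpace.rankOne ℂ η ξ) ζ =
      ⟪(u : H →L[ℂ] H) ξ, ζ⟫_ℂ • (u : H →L[ℂ] H) η := by
  rw [Unitary.conjStarAlgAut_apply, ContinuousLinearMap.star_eq_adjoint]
  simp [ContinuousLinearMap.adjoint_inner_right]

theorem exists_conjStarAlgAut_eq_and_inner_eq_norm (β : Aut(H)) (ξ : H) :
    ∃ u : 𝓤(H), Ad u = β ∧ ⟪(u : H →L[ℂ] H) ξ, ξ⟫_ℂ = ‖⟪(u : H →L[ℂ] H) ξ, ξ⟫_ℂ‖ := by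
  obtain ⟨u, hu⟩ := exists_unitary_conjStarAlgAut_eq β
  set z := ⟪(u : H →L[ℂ] H) ξ, ξ⟫_ℂ with hz
  refine ⟨Circle.exp z.arg • u, by rw [conjStarAlgAut_circle_smul, hu], ?_⟩
  have : ⟪((Circle.exp z.arg • u : 𝓤(H)) : H →L[ℂ] H) ξ, ξ⟫_ℂ = ‖z‖ := by
    rw [circle_smul_apply, Circle.smul_def, inner_smul_left, ← hz, ← Circle.coe_inv_eq_conj,
      ← Circle.exp_neg, Circle.coe_exp]
    nth_rw 2 [← Complex.norm_mul_exp_arg_mul_I z]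
    rw [mul_left_comm, ← Complex.exp_add]
    simp
  rw [this]
  simp

variable {X : Type*} [TopologicalSpace X]

/-- With `⟪uₓ ξ, ξ⟫ ≥ 0`, the unitary `uₓ` is recovered from `βₓ` on rank one operators:
`βₓ(|η⟩⟨ξ|) ξ = ⟪uₓ ξ, ξ⟫ uₓ η` and `⟪ξ, βₓ(|ξ⟩⟨ξ|) ξ⟫ = ⟪uₓ ξ, ξ⟫²`. -/
theorem exists_strongContinuous_nhds [Nontrivial H] {β : X → Aut(H)} (hβ : WeakContinuous β)
    {x₀ : X} (h₀ : β x₀ = 1) :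
    ∃ u : X → 𝓤(H), (∀ x, Ad (u x) = β x) ∧ u x₀ = 1 ∧
      ∃ N ∈ 𝓝 x₀, StrongContinuous fun x : N => u x := by
  obtain ⟨ξ, hξ⟩ := exists_norm_eq H zero_le_one
  choose u hu hpos using fun x => exists_conjStarAlgAut_eq_and_inner_eq_norm (β x) ξ
  set p : X → ℝ := fun x => (⟪ξ, β x (InnerProductSpace.rankOne ℂ ξ ξ) ξ⟫_ℂ).re with hp
  have p_cont : Continuous p := Complex.continuous_re.comp (hβ _ _ _)
  have p_eq (x) : p x = ‖⟪(u x : H →L[ℂ] H) ξ, ξ⟫_ℂ‖ ^ 2 := by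
    rw [hp]
    beta_reduce
    rw [← hu, conjStarAlgAut_rankOne_apply, inner_smul_right, ← inner_conj_symm ξ,
      Complex.mul_conj, Complex.normSq_eq_norm_sq, Complex.ofReal_re]
  have p_zero : p x₀ ≠ 0 := by simp [hp, h₀, hξ]
  have u_cont : StrongContinuous fun x : {x | p x ≠ 0} => u x := by
    refine strongContinuous_of_continuous_inner fun ζ η => ?_
    have inner_eq (x) (hx : p x ≠ 0) : ⟪ζ, (u x : H →L[ℂ] H) η⟫_ℂ =
        (√(p x) : ℂ)⁻¹ * ⟪ζ, β x (InnerProductSpace.rankOne ℂ η ξ) ξ⟫_ℂ := by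
      rw [← hu, conjStarAlgAut_rankOne_apply, inner_smul_right, hpos, p_eq,
        Real.sqrt_sq (norm_nonneg _), inv_mul_cancel_left₀]
      simpa [p_eq] using hx
    simp only [fun x : {x | p x ≠ 0} => inner_eq x x.2]
    have sqrt_p_cont : Continuous fun x : {x | p x ≠ 0} => (√(p x) : ℂ) := by fun_prop
    refine (sqrt_p_cont.inv₀ fun x => ?_).mul ((hβ _ _ _).comp continuous_subtype_val)
    simpa [p_eq] using x.2
  refine ⟨fun x => (u x₀)⁻¹ * u x, fun x => ?_, inv_mul_cancel _, _,
    p_cont.continuousAt.preimage_mem_nhds (isOpen_ne.mem_nhds p_zero), ?_⟩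
  · rw [map_mul, map_inv, hu, hu, h₀, inv_one, one_mul]
  · exact StrongContinuous.mul (fun _ => continuous_const) u_cont

end ImplementingUnitaries

section CircleLift

variable {X : Type*} [TopologicalSpace X]

theorem exists_continuous_circleExp_eq [SimplyConnectedSpace X] [LocallyPathConnectedSpace X]
    {f : X → Circle} (hf : Continuous f) {x₀ : X} {a : ℝ}
    (h₀ : Circle.exp a = f x₀) :
    ∃ φ : X → ℝ, Continuous φ ∧ φ x₀ = a ∧ ∀ x, Circle.exp (φ x) = f x := by
  obtain ⟨φ, ⟨hφ₀, hφ⟩, -⟩ := Circle.isCoveringMap_exp.existsUnique_continuousMap_lifts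
    ⟨f, hf⟩ x₀ a h₀
  exact ⟨φ, φ.continuous, hφ₀, congrFun hφ⟩

theorem eq_of_circleExp_eq [PreconnectedSpace X] {φ ψ : X → ℝ} (hφ : Continuous φ)
    (hψ : Continuous ψ) (h : ∀ x, Circle.exp (φ x) = Circle.exp (ψ x)) {x₀ : X}
    (h₀ : φ x₀ = ψ x₀) : φ = ψ :=
  Circle.isCoveringMap_exp.eq_of_comp_eq hφ hψ (funext h) x₀ h₀

theorem eq_of_forall_nonneg_circleExp_mul_eq {a b : ℝ}
    (h : ∀ t : ℝ, 0 ≤ t → Circle.exp (t * a) = Circle.exp (t * b)) : a = b := by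
  have habs : (fun t : ℝ => |t| * a) = fun t => |t| * b :=
    eq_of_circleExp_eq (by fun_prop) (by fun_prop) (fun t => h |t| (abs_nonneg t)) (x₀ := 0)
      (by simp)
  simpa using congrFun habs 1

variable {F G : Type*} [NormedAddCommGroup F] [NormedSpace ℝ F] [NormedAddCommGroup G]
  [NormedSpace ℝ G]

theorem exists_bilinear_of_continuous_bicharacter {c : F → G → Circle}
    (hc : Continuous fun p : F × G => c p.1 p.2)
    (add_left : ∀ x x' y, c (x + x') y = c x y * c x' y)
    (add_right : ∀ x y y', c x (y + y') = c x y * c x y') :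
    ∃ B : F →ₗ[ℝ] G →ₗ[ℝ] ℝ, ∀ x y, c x y = Circle.exp (B x y) := by
  have c_zero : c 0 0 = 1 := by simpa using add_left 0 0 0
  obtain ⟨φ, φ_cont, φ_zero, hφ⟩ := exists_continuous_circleExp_eq hc (x₀ := 0) (a := 0)
    (by simpa using c_zero.symm)
  have φ_add_left (x x' y) : φ (x + x', y) = φ (x, y) + φ (x', y) :=
    congrFun (eq_of_circleExp_eq (φ := fun p : F × F × G => φ (p.1 + p.2.1, p.2.2))
      (ψ := fun p => φ (p.1, p.2.2) + φ (p.2.1, p.2.2)) (x₀ := 0) (by fun_prop) (by fun_prop)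
      (fun p => by simp only [Circle.exp_add, hφ, add_left]) (by simp [Prod.mk_zero_zero, φ_zero]))
      (x, x', y)
  have φ_add_right (x y y') : φ (x, y + y') = φ (x, y) + φ (x, y') :=
    congrFun (eq_of_circleExp_eq (φ := fun p : F × G × G => φ (p.1, p.2.1 + p.2.2))
      (ψ := fun p => φ (p.1, p.2.1) + φ (p.1, p.2.2)) (x₀ := 0) (by fun_prop) (by fun_prop)
      (fun p => by simp only [Circle.exp_add, hφ, add_right]) (by simp [Prod.mk_zero_zero, φ_zero]))
      (x, y, y')
  refine ⟨LinearMap.mk₂ ℝ (fun x y => φ (x, y)) φ_add_left (fun r x y => ?_) φ_add_right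
    (fun r x y => ?_), fun x y => (hφ (x, y)).symm⟩
  · exact map_real_smul (AddMonoidHom.mk' (fun x => φ (x, y)) fun x x' => φ_add_left x x' y)
      (show Continuous fun x => φ (x, y) by fun_prop) r x
  · exact map_real_smul (AddMonoidHom.mk' (fun y => φ (x, y)) fun y y' => φ_add_right x y y')
      (show Continuous fun y => φ (x, y) by fun_prop) r y

end CircleLift

section RealCocycle

variable {M : Type*} [NormedAddCommGroup M] [NormedSpace ℝ M]

theorem integral_zero_one_sub_integral_comp_add {g : ℝ → M} (hg : Continuous g) (t : ℝ) :
    (∫ x in (0 : ℝ)..1, g x) - ∫ x in (0 : ℝ)..1, g (t + x) =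
      ∫ x in (0 : ℝ)..t, (g x - g (x + 1)) := by
  have hint (a b) : IntervalIntegrable g volume a b := hg.intervalIntegrable a b
  have hint' : IntervalIntegrable (fun x => g (x + 1)) volume 0 t :=
    (hg.comp (continuous_add_const 1)).intervalIntegrable 0 t
  rw [intervalIntegral.integral_sub (hint _ _) hint', intervalIntegral.integral_comp_add_left,
    intervalIntegral.integral_comp_add_right, add_zero, zero_add,
    sub_eq_sub_iff_add_eq_add,
    intervalIntegral.integral_add_adjacent_intervals (hint _ _) (hint _ _),
    intervalIntegral.integral_add_adjacent_intervals (hint _ _) (hint _ _)]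

theorem integral_add_integral_sub_integral_add {g : ℝ → M} (hg : Continuous g) (s t : ℝ) :
    (∫ x in (0 : ℝ)..s, g x) + (∫ x in (0 : ℝ)..t, g x) - ∫ x in (0 : ℝ)..s + t, g x =
      ∫ x in (0 : ℝ)..t, (g x - g (s + x)) := by
  have hint (a b) : IntervalIntegrable g volume a b := hg.intervalIntegrable a b
  have hint' : IntervalIntegrable (fun x => g (s + x)) volume 0 t :=
    (hg.comp (continuous_const_add s)).intervalIntegrable 0 t
  rw [intervalIntegral.integral_sub (hint _ _) hint', intervalIntegral.integral_comp_add_left,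
    add_zero, ← intervalIntegral.integral_add_adjacent_intervals (hint 0 s) (hint s (s + t))]
  abel

/-- Averaging the cocycle over a unit interval trivializes it up to a boundary term, which the
second integral corrects. -/
theorem exists_continuous_coboundary [CompleteSpace M] {μ : ℝ → ℝ → M}
    (hμ : Continuous fun p : ℝ × ℝ => μ p.1 p.2)
    (cocycle : ∀ s t u, μ s t + μ (s + t) u = μ s (t + u) + μ t u) :
    ∃ a : ℝ → M, Continuous a ∧ ∀ s t, μ s t = a s + a t - a (s + t) := by
  have hleft (s) : Continuous (μ s) := hμ.comp (Continuous.prodMk_right s)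
  have hright : Continuous fun x => μ x 1 := hμ.comp (Continuous.prodMk_left 1)
  have hint (s a b) : IntervalIntegrable (μ s) volume a b := (hleft s).intervalIntegrable a b
  have average (s t) : (∫ x in (0 : ℝ)..1, μ s x) + (∫ x in (0 : ℝ)..1, μ t x) -
      (∫ x in (0 : ℝ)..1, μ (s + t) x) = μ s t + ∫ x in (0 : ℝ)..t, (μ s x - μ s (x + 1)) := by
    have hshift : IntervalIntegrable (fun x => μ s (t + x)) volume 0 1 :=
      ((hleft s).comp (continuous_const_add t)).intervalIntegrable 0 1
    have hpoint (x) : μ s x + μ t x - μ (s + t) x = μ s t + (μ s x - μ s (t + x)) := by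
      rw [eq_sub_of_add_eq' (cocycle s t x)]
      abel
    rw [← integral_zero_one_sub_integral_comp_add (hleft s),
      ← intervalIntegral.integral_add (hint _ _ _) (hint _ _ _),
      ← intervalIntegral.integral_sub ((hint _ _ _).add (hint _ _ _)) (hint _ _ _)]
    simp only [hpoint]
    rw [intervalIntegral.integral_add intervalIntegrable_const ((hint _ _ _).sub hshift),
      intervalIntegral.integral_sub (hint _ _ _) hshift, intervalIntegral.integral_const,
      sub_zero, one_smul]
  refine ⟨fun t => (∫ x in (0 : ℝ)..1, μ t x) - ∫ x in (0 : ℝ)..t, μ x 1, ?_, fun s t => ?_⟩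
  · exact (intervalIntegral.continuous_parametric_intervalIntegral_of_continuous' hμ 0 1).sub
      (intervalIntegral.continuous_primitive (fun a b => hright.intervalIntegrable a b) 0)
  · have boundary : ∫ x in (0 : ℝ)..t, (μ s x - μ s (x + 1)) =
        ∫ x in (0 : ℝ)..t, (μ x 1 - μ (s + x) 1) :=
      intervalIntegral.integral_congr fun x _ => sub_eq_sub_iff_add_eq_add.2 (by
        rw [cocycle s x 1, add_comm])
    rw [← integral_add_integral_sub_integral_add hright] at boundary
    rw [eq_sub_of_add_eq (average s t).symm, boundary]
    beta_reduce
    abel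

end RealCocycle

section ProjectiveRep

variable {G : Type*} [TopologicalSpace G]
variable {H : Type*} [NormedAddCommGroup H] [InnerProductSpace ℂ H] [CompleteSpace H]

/-- A strongly continuous projective unitary representation of `G` with multiplier `ω`. An ordinary
representation is one with multiplier `1`. -/
structure IsProjectiveRep [Add G] (ω : G → G → Circle) (V : G → 𝓤(H)) : Prop where
  strongContinuous : StrongContinuous V
  mul : ∀ x y, V x * V y = ω x y • V (x + y)

theorem exists_isProjectiveRep_of_conjStarAlgAut_eq [AddMonoid G] {V : G → 𝓤(H)}
    (hV : StrongContinuous V) {β : AddChar G Aut(H)} (hβ : ∀ x, Ad (V x) = β x) :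
    ∃ ω, IsProjectiveRep ω V := by
  have hmul (x y) : ∃ c : Circle, V x * V y = c • V (x + y) :=
    exists_circle_smul_of_conjStarAlgAut_eq (by rw [map_mul, hβ, hβ, hβ, β.map_add_eq_mul])
  choose ω hω using hmul
  exact ⟨ω, hV, hω⟩

namespace IsProjectiveRep

theorem circle_smul [Add G] {ω ω' : G → G → Circle} {V : G → 𝓤(H)} (hV : IsProjectiveRep ω V)
    {c : G → Circle} (hc : Continuous c) (h : ∀ x y, c x * c y * ω x y = ω' x y * c (x + y)) :
    IsProjectiveRep ω' fun x => c x • V x where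
  strongContinuous := hV.strongContinuous.circle_smul hc
  mul x y := by rw [smul_mul_smul_comm, hV.mul, smul_smul, h, ← smul_smul]

theorem continuous_multiplier [Add G] [ContinuousAdd G] [Nontrivial H] {ω : G → G → Circle}
    {V : G → 𝓤(H)} (hV : IsProjectiveRep ω V) : Continuous fun p : G × G => ω p.1 p.2 :=
  ((hV.strongContinuous.comp continuous_fst).mul
    (hV.strongContinuous.comp continuous_snd)).continuous_phase
      (hV.strongContinuous.comp continuous_add) fun p => hV.mul p.1 p.2

theorem multiplier_cocycle [AddSemigroup G] [Nontrivial H] {ω : G → G → Circle} {V : G → 𝓤(H)}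
    (hV : IsProjectiveRep ω V) (x y z : G) :
    ω x y * ω (x + y) z = ω x (y + z) * ω y z := by
  apply circle_smul_left_injective (V (x + y + z))
  calc (ω x y * ω (x + y) z) • V (x + y + z) = V x * V y * V z := by
        rw [hV.mul, smul_mul_assoc, hV.mul, smul_smul]
    _ = V x * (V y * V z) := mul_assoc _ _ _
    _ = (ω x (y + z) * ω y z) • V (x + y + z) := by
        rw [hV.mul, mul_smul_comm, hV.mul, smul_smul, add_assoc, mul_comm]

/-- Rephasing multiplies `ω` by a symmetric factor, so `ω x y / ω y x` only depends on the
implemented automorphisms. -/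
theorem multiplier_mul_comm_of_conjStarAlgAut_eq [AddCommMagma G] [Nontrivial H]
    {ω ω' : G → G → Circle} {V V' : G → 𝓤(H)} (hV : IsProjectiveRep ω V)
    (hV' : IsProjectiveRep ω' V') (h : ∀ x, Ad (V x) = Ad (V' x)) (x y : G) :
    ω x y * ω' y x = ω y x * ω' x y := by
  choose c hc using fun x => exists_circle_smul_of_conjStarAlgAut_eq (h x)
  have key (x y) : c x * c y * ω' x y = ω x y * c (x + y) := by
    apply circle_smul_left_injective (V' (x + y))
    calc (c x * c y * ω' x y) • V' (x + y) = V x * V y := by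
          rw [hc, hc, smul_mul_smul_comm, hV'.mul, smul_smul]
      _ = (ω x y * c (x + y)) • V' (x + y) := by rw [hV.mul, hc, smul_smul]
  apply mul_right_cancel (b := c (x + y))
  calc ω x y * ω' y x * c (x + y) = c x * c y * ω' x y * ω' y x := by rw [key]; ac_rfl
    _ = c y * c x * ω' y x * ω' x y := by ac_rfl
    _ = ω y x * ω' x y * c (x + y) := by rw [key, add_comm y x]; ac_rfl

theorem exists_representation_of_real [Nontrivial H] {ω : ℝ → ℝ → Circle} {V : ℝ → 𝓤(H)}
    (hV : IsProjectiveRep ω V) :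
    ∃ c : ℝ → Circle, IsProjectiveRep 1 fun t => c t • V t := by
  obtain ⟨θ, hθ⟩ := Circle.exp_surjective (ω 0 0)
  obtain ⟨φ, φ_cont, -, hφ⟩ :=
    exists_continuous_circleExp_eq hV.continuous_multiplier (x₀ := 0) hθ
  have φ_cocycle (s t u) : φ (s, t) + φ (s + t, u) = φ (s, t + u) + φ (t, u) :=
    congrFun (eq_of_circleExp_eq (x₀ := 0)
      (φ := fun p : ℝ × ℝ × ℝ => φ (p.1, p.2.1) + φ (p.1 + p.2.1, p.2.2))
      (ψ := fun p => φ (p.1, p.2.1 + p.2.2) + φ (p.2.1, p.2.2)) (by fun_prop) (by fun_prop)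
      (fun p => by simp only [Circle.exp_add, hφ, hV.multiplier_cocycle])
      (by simp only [Prod.fst_zero, Prod.snd_zero, add_zero])) (s, t, u)
  obtain ⟨a, a_cont, ha⟩ := exists_continuous_coboundary (μ := fun s t => φ (s, t)) φ_cont φ_cocycle
  refine ⟨fun t => Circle.exp (-a t), hV.circle_smul (by fun_prop) fun s t => ?_⟩
  rw [← hφ (s, t), ha, Pi.one_apply, Pi.one_apply, one_mul, ← Circle.exp_add, ← Circle.exp_add]
  ring_nf

end IsProjectiveRep

end ProjectiveRep

section OneParameterGroup

theorem continuous_of_forall_continuousOn_Icc {Y : Type*} [TopologicalSpace Y] {f : ℝ → Y} {δ : ℝ}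
    (hδ : 0 < δ) (hf : ∀ n : ℤ, ContinuousOn f (Set.Icc (n • δ) ((n + 1) • δ))) :
    Continuous f := by
  refine continuous_iff_continuousAt.2 fun t => ?_
  obtain ⟨n, ⟨hnt, htn⟩, -⟩ := existsUnique_zsmul_near_of_pos hδ t
  have hpred : (n - 1) • δ < n • δ := zsmul_lt_zsmul_left hδ (by lia)
  have hunion : ContinuousOn f (Set.Icc ((n - 1) • δ) ((n + 1) • δ)) := by
    rw [← Set.Icc_union_Icc_eq_Icc hpred.le (hnt.trans htn.le)]
    exact ContinuousOn.union_of_isClosed (by simpa using hf (n - 1)) (hf n) isClosed_Icc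
      isClosed_Icc
  exact hunion.continuousAt (Icc_mem_nhds (hpred.trans_le hnt) htn)

variable {H : Type*} [NormedAddCommGroup H] [InnerProductSpace ℂ H] [CompleteSpace H]

theorem exists_strongContinuous_of_continuousOn_Icc {γ : AddChar ℝ Aut(H)} {u : ℝ → 𝓤(H)}
    (hu : ∀ t, Ad (u t) = γ t) (u_zero : u 0 = 1) {δ : ℝ} (hδ : 0 < δ)
    (u_cont : ∀ ξ : H, ContinuousOn (fun t => (u t : H →L[ℂ] H) ξ) (Set.Icc 0 δ)) :
    ∃ V : ℝ → 𝓤(H), StrongContinuous V ∧ ∀ t, Ad (V t) = γ t := by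
  set V : ℝ → 𝓤(H) := fun t => u δ ^ toIcoDiv hδ 0 t * u (toIcoMod hδ 0 t) with hV
  have V_eq (n : ℤ) {t : ℝ} (ht : t ∈ Set.Icc (n • δ) ((n + 1) • δ)) :
      V t = u δ ^ n * u (t - n • δ) := by
    rcases ht.2.eq_or_lt with rfl | hlt
    · have hdiv : toIcoDiv hδ 0 ((n + 1) • δ) = n + 1 :=
        toIcoDiv_eq_of_sub_zsmul_mem_Ico hδ (by rw [sub_self, zero_add]; exact ⟨le_rfl, hδ⟩)
      rw [hV]
      beta_reduce
      rw [← self_sub_toIcoDiv_zsmul, hdiv, sub_self, u_zero, mul_one, zpow_add_one, add_smul,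
        one_smul, add_sub_cancel_left]
    · have hdiv : toIcoDiv hδ 0 t = n := toIcoDiv_eq_of_sub_zsmul_mem_Ico hδ
        ⟨sub_nonneg.2 ht.1, by rw [add_smul, one_smul] at hlt; linarith⟩
      rw [← hdiv]
      rfl
  refine ⟨V, fun ξ => continuous_of_forall_continuousOn_Icc hδ fun n => ?_, fun t => ?_⟩
  · refine ContinuousOn.congr (f := fun t => ((u δ ^ n : 𝓤(H)) : H →L[ℂ] H)
      ((u (t - n • δ) : H →L[ℂ] H) ξ)) ?_ fun t ht => by rw [V_eq n ht]; rfl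
    refine (ContinuousLinearMap.continuous _).comp_continuousOn
      ((u_cont ξ).comp (by fun_prop) fun t ht => ⟨sub_nonneg.2 ht.1, ?_⟩)
    have := ht.2
    rw [add_smul, one_smul] at this
    linarith
  · rw [hV, map_mul, map_zpow, hu, hu, ← γ.map_zsmul_eq_zpow, ← γ.map_add_eq_mul,
      toIcoDiv_zsmul_sub_toIcoMod]

theorem exists_representation_of_weakContinuous [Nontrivial H] {γ : AddChar ℝ Aut(H)}
    (hγ : WeakContinuous γ) :
    ∃ V : ℝ → 𝓤(H), IsProjectiveRep 1 V ∧ ∀ t, Ad (V t) = γ t := by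
  obtain ⟨u, hu, u_zero, N, hN, u_cont⟩ := exists_strongContinuous_nhds hγ γ.map_zero_eq_one
  obtain ⟨δ, hδ, hδN⟩ := Metric.nhds_basis_closedBall.mem_iff.1 hN
  have hIcc : Set.Icc 0 δ ⊆ N := fun t ht => hδN (by
    rw [Metric.mem_closedBall, Real.dist_0_eq_abs, abs_of_nonneg ht.1]
    exact ht.2)
  obtain ⟨V, V_cont, hV⟩ := exists_strongContinuous_of_continuousOn_Icc hu u_zero hδ fun ξ =>
    (continuousOn_iff_continuous_domRestrict.2 (u_cont ξ)).mono hIcc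
  obtain ⟨ω, hω⟩ := exists_isProjectiveRep_of_conjStarAlgAut_eq V_cont hV
  obtain ⟨c, hc⟩ := hω.exists_representation_of_real
  exact ⟨fun t => c t • V t, hc, fun t => by rw [conjStarAlgAut_circle_smul, hV]⟩

end OneParameterGroup

section VectorSpace

variable {H : Type*} [NormedAddCommGroup H] [InnerProductSpace ℂ H] [CompleteSpace H]

namespace IsProjectiveRep

theorem comp {F G : Type*} [TopologicalSpace F] [AddZeroClass F] [TopologicalSpace G]
    [AddZeroClass G] {ω : G → G → Circle} {V : G → 𝓤(H)} (hV : IsProjectiveRep ω V) (f : F →+ G)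
    (hf : Continuous f) : IsProjectiveRep (fun x y => ω (f x) (f y)) fun x => V (f x) where
  strongContinuous := hV.strongContinuous.comp hf
  mul x y := by rw [hV.mul, map_add]

theorem mul_of_commutation {G : Type*} [TopologicalSpace G] [Add G] {ω σ c : G → G → Circle}
    {V W : G → 𝓤(H)} (hV : IsProjectiveRep ω V) (hW : IsProjectiveRep σ W)
    (h : ∀ x y, W x * V y = c x y • (V y * W x)) :
    IsProjectiveRep (fun x y => c x y * (ω x y * σ x y)) fun x => V x * W x where
  strongContinuous := hV.strongContinuous.mul hW.strongContinuous
  mul x y := by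
    calc V x * W x * (V y * W y) = V x * (W x * V y) * W y := by simp only [mul_assoc]
      _ = c x y • (V x * V y * (W x * W y)) := by
          rw [h, mul_smul_comm, smul_mul_assoc]
          simp only [mul_assoc]
      _ = (c x y * (ω x y * σ x y)) • (V (x + y) * W (x + y)) := by
          rw [hV.mul, hW.mul, smul_mul_smul_comm, smul_smul]

variable {F G : Type*} [NormedAddCommGroup F] [NormedSpace ℝ F] [NormedAddCommGroup G]
  [NormedSpace ℝ G]

theorem exists_bilinear_commutation [Nontrivial H] {ω : F → F → Circle} {σ : G → G → Circle}
    {V : F → 𝓤(H)} {W : G → 𝓤(H)} (hV : IsProjectiveRep ω V) (hW : IsProjectiveRep σ W)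
    (hcomm : ∀ x y, Commute (Ad (V x)) (Ad (W y))) :
    ∃ B : F →ₗ[ℝ] G →ₗ[ℝ] ℝ, ∀ x y, V x * W y = Circle.exp (B x y) • (W y * V x) := by
  have hphase (x y) : ∃ c : Circle, V x * W y = c • (W y * V x) :=
    exists_circle_smul_of_conjStarAlgAut_eq (by rw [map_mul, map_mul]; exact hcomm x y)
  choose c hc using hphase
  have c_cont : Continuous fun p : F × G => c p.1 p.2 :=
    have hV' := hV.strongContinuous.comp continuous_fst
    have hW' := hW.strongContinuous.comp continuous_snd
    (hV'.mul hW').continuous_phase (hW'.mul hV') fun p => hc p.1 p.2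
  have add_left (x x' y) : c (x + x') y = c x y * c x' y := by
    apply mul_left_cancel (a := ω x x')
    apply circle_smul_left_injective (W y * V (x + x'))
    calc (ω x x' * c (x + x') y) • (W y * V (x + x')) = V x * V x' * W y := by
          rw [hV.mul, smul_mul_assoc, hc, smul_smul]
      _ = (c x y * c x' y) • (W y * (V x * V x')) := by
          rw [mul_assoc, hc, mul_smul_comm, ← mul_assoc, hc, smul_mul_assoc, smul_smul, mul_assoc,
            mul_comm (c x' y)]
      _ = (ω x x' * (c x y * c x' y)) • (W y * V (x + x')) := by
          rw [hV.mul, mul_smul_comm, smul_smul, mul_comm]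
  have add_right (x y y') : c x (y + y') = c x y * c x y' := by
    apply mul_left_cancel (a := σ y y')
    apply circle_smul_left_injective (W (y + y') * V x)
    calc (σ y y' * c x (y + y')) • (W (y + y') * V x) = V x * (W y * W y') := by
          rw [hW.mul, mul_smul_comm, hc, smul_smul]
      _ = (c x y * c x y') • (W y * W y' * V x) := by
          rw [← mul_assoc, hc, smul_mul_assoc, mul_assoc, hc, mul_smul_comm, smul_smul, mul_assoc]
      _ = (σ y y' * (c x y * c x y')) • (W (y + y') * V x) := by
          rw [hW.mul, smul_mul_assoc, smul_smul, mul_comm]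
  obtain ⟨B, hB⟩ := exists_bilinear_of_continuous_bicharacter c_cont add_left add_right
  exact ⟨B, fun x y => by rw [hc, hB]⟩

end IsProjectiveRep

variable {F : Type*} [NormedAddCommGroup F] [NormedSpace ℝ F]

theorem exists_isProjectiveRep_of_weakContinuous_line [Nontrivial H] {β : AddChar F Aut(H)}
    {e : F} (hβ : WeakContinuous fun t : ℝ => β (t • e)) (f : F →L[ℝ] ℝ) :
    ∃ V : F → 𝓤(H), IsProjectiveRep 1 V ∧ ∀ x, Ad (V x) = β (f x • e) := by
  obtain ⟨V, hV, hVβ⟩ := exists_representation_of_weakContinuous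
    (γ := β.compAddMonoidHom (LinearMap.toSpanSingleton ℝ F e).toAddMonoidHom) hβ
  exact ⟨fun x => V (f x), hV.comp (f : F →+ ℝ) f.continuous, fun x => hVβ (f x)⟩

theorem exists_bilinear_isProjectiveRep [Nontrivial H] {ι : Type*} [Finite ι]
    (b : Module.Basis ι ℝ F) {β : AddChar F Aut(H)}
    (hβ : ∀ i, WeakContinuous fun t : ℝ => β (t • b i)) :
    ∃ (B : F →ₗ[ℝ] F →ₗ[ℝ] ℝ) (V : F → 𝓤(H)),
      IsProjectiveRep (fun x y => Circle.exp (B x y)) V ∧ ∀ x, Ad (V x) = β x := by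
  classical
  cases nonempty_fintype ι
  have := b.finiteDimensional_of_finite
  suffices ∀ s : Finset ι, ∃ (B : F →ₗ[ℝ] F →ₗ[ℝ] ℝ) (V : F → 𝓤(H)),
      IsProjectiveRep (fun x y => Circle.exp (B x y)) V ∧
        ∀ x, Ad (V x) = β (∑ i ∈ s, b.coord i x • b i) by
    simpa only [Module.Basis.coord_apply, b.sum_repr] using this Finset.univ
  intro s
  induction s using Finset.induction with
  | empty => exact ⟨0, 1, ⟨fun _ => continuous_const, by simp⟩, by simp⟩
  | insert i s his ih =>
    obtain ⟨B, V, hV, hVβ⟩ := ih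
    obtain ⟨W, hW, hWβ⟩ :=
      exists_isProjectiveRep_of_weakContinuous_line (hβ i) (b.coord i).toContinuousLinearMap
    obtain ⟨B', hB'⟩ := hW.exists_bilinear_commutation hV fun x y => by
      rw [hVβ, hWβ, Commute, SemiconjBy, ← β.map_add_eq_mul, ← β.map_add_eq_mul, add_comm]
    refine ⟨B' + B, fun x => V x * W x, ?_, fun x => ?_⟩
    · simpa [Circle.exp_add] using hV.mul_of_commutation hW hB'
    · rw [map_mul, hVβ, hWβ, ← β.map_add_eq_mul, Finset.sum_insert his, add_comm]
      rfl

end VectorSpace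

section CocycleConjugacy

variable {S : Type*} [AddCommMonoid S] [TopologicalSpace S]
variable {H : Type*} [NormedAddCommGroup H] [InnerProductSpace ℂ H] [CompleteSpace H]
variable {K : Type*} [NormedAddCommGroup K] [InnerProductSpace ℂ K] [CompleteSpace K]

/-- The unitaries `V x` implement the semigroup `α`, that is, `αₓ = Ad (V x)` for all `x`. -/
def Implements (V : S → 𝓤(H)) (α : E0Semigroup S H) : Prop :=
  ∀ x T, α.toFun x T = Ad (V x) T

theorem conjStarAlgAut_conjUnitary (U : H ≃ₗᵢ[ℂ] K) (u : 𝓤(H)) (T : K →L[ℂ] K) :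
    (Ad (conjUnitary U u) : Aut(K)) T =
      U.conjStarAlgEquiv ((Ad u : Aut(H)) (U.conjStarAlgEquiv.symm T)) := by
  rw [Unitary.conjStarAlgAut_apply, Unitary.conjStarAlgAut_apply, map_mul, map_mul, map_star,
    StarAlgEquiv.apply_symm_apply, coe_conjUnitary]

theorem IsProjectiveRep.conjUnitary {ω : S → S → Circle} {V : S → 𝓤(H)}
    (hV : IsProjectiveRep ω V) (U : H ≃ₗᵢ[ℂ] K) :
    IsProjectiveRep ω fun x => conjUnitary U (V x) where
  strongContinuous := hV.strongContinuous.conjUnitary U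
  mul x y := by
    have h := congrArg (fun u : 𝓤(H) => U.conjStarAlgEquiv (u : H →L[ℂ] H)) (hV.mul x y)
    refine Subtype.ext ((map_mul U.conjStarAlgEquiv _ _).symm.trans (h.trans ?_))
    exact map_smul U.conjStarAlgEquiv (ω x y : ℂ) _

theorem circle_smul_mul_inv_circle_smul (c : Circle) (u v : 𝓤(H)) :
    (c • u) * (c • v)⁻¹ = u * v⁻¹ := by
  rw [mul_inv_eq_iff_eq_mul, mul_smul_comm, inv_mul_cancel_right]

theorem Implements.apply_unitary {V : S → 𝓤(H)} {α : E0Semigroup S H} (hV : Implements V α)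
    (x : S) (u : 𝓤(H)) : α.toFun x u = ((V x * u * (V x)⁻¹ : 𝓤(H)) : H →L[ℂ] H) := by
  rw [hV, Unitary.conjStarAlgAut_apply]
  rfl

theorem IsProjectiveRep.cocycle_mul {ω : S → S → Circle} {V W : S → 𝓤(H)}
    {α : E0Semigroup S H} (hV : IsProjectiveRep ω V) (hα : Implements V α) (hW : IsCocycle α W) :
    IsProjectiveRep ω fun x => W x * V x where
  strongContinuous := StrongContinuous.mul hW.continuous hV.strongContinuous
  mul x y := by
    have hWmul : W x * (V x * W y * (V x)⁻¹) = W (x + y) := Subtype.ext (by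
      rw [← hW.mul, hα.apply_unitary]
      rfl)
    calc W x * V x * (W y * V y) = W x * (V x * W y * (V x)⁻¹) * (V x * V y) := by group
      _ = ω x y • (W (x + y) * V (x + y)) := by rw [hWmul, hV.mul, mul_smul_comm]

theorem CocycleConjugate.exists_isProjectiveRep {α : E0Semigroup S H} {β : E0Semigroup S K}
    (h : CocycleConjugate α β) {ω : S → S → Circle} {V : S → 𝓤(K)} (hV : IsProjectiveRep ω V)
    (hβ : Implements V β) :
    ∃ V' : S → 𝓤(H), IsProjectiveRep ω V' ∧ Implements V' α := by
  obtain ⟨U, W, hW, hα⟩ := h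
  refine ⟨fun x => ConeE0.conjUnitary U.symm (W x * V x),
    (hV.cocycle_mul hβ hW).conjUnitary U.symm, fun x T => ?_⟩
  rw [conjStarAlgAut_conjUnitary, map_mul, StarAlgEquiv.mul_apply, ← hβ, ← hα,
    ← LinearIsometryEquiv.symm_conjStarAlgEquiv, StarAlgEquiv.symm_symm,
    StarAlgEquiv.symm_apply_apply, StarAlgEquiv.symm_apply_apply]

theorem IsProjectiveRep.isCocycle_mul_inv {ω : S → S → Circle} {V V' : S → 𝓤(H)}
    {α : E0Semigroup S H} (hV : IsProjectiveRep ω V) (hV' : IsProjectiveRep ω V')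
    (hα : Implements V α) : IsCocycle α fun x => V' x * (V x)⁻¹ where
  continuous := hV'.strongContinuous.mul hV.strongContinuous.inv
  mul x y := by
    rw [hα.apply_unitary]
    suffices V' x * (V x)⁻¹ * (V x * (V' y * (V y)⁻¹) * (V x)⁻¹) = V' (x + y) * (V (x + y))⁻¹ from
      congrArg Subtype.val this
    calc _ = V' x * V' y * (V x * V y)⁻¹ := by group
      _ = _ := by rw [hV.mul, hV'.mul, circle_smul_mul_inv_circle_smul]

theorem cocycleConjugate_of_isProjectiveRep (U : H ≃ₗᵢ[ℂ] K) {ω : S → S → Circle}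
    {V : S → 𝓤(H)} {V' : S → 𝓤(K)} {α : E0Semigroup S H} {β : E0Semigroup S K}
    (hV : IsProjectiveRep ω V) (hα : Implements V α) (hV' : IsProjectiveRep ω V')
    (hβ : Implements V' β) : CocycleConjugate α β := by
  refine ⟨U, _, hV'.isCocycle_mul_inv (hV.conjUnitary U) hβ, fun x T => ?_⟩
  rw [hβ, ← StarAlgEquiv.mul_apply, ← map_mul, inv_mul_cancel_right, conjStarAlgAut_conjUnitary, hα]

end CocycleConjugacy

section CommutatorForm

variable {F : Type*} [AddCommGroup F] [Module ℝ F]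

/-- The antisymmetrization of a bilinear form `B`: it governs the commutation relations
`V x * V y = exp (i (B x y - B y x)) V y * V x` of a projective representation with multiplier
`exp (i B)`. -/
def commutatorForm (B : F →ₗ[ℝ] F →ₗ[ℝ] ℝ) : F →ₗ[ℝ] F →ₗ[ℝ] ℝ :=
  B - B.flip

theorem commutatorForm_apply (B : F →ₗ[ℝ] F →ₗ[ℝ] ℝ) (x y : F) :
    commutatorForm B x y = B x y - B y x :=
  rfl

theorem span_eq_top_of_forall_exists_sub {P : PointedCone ℝ F}
    (h : ∀ z, ∃ x ∈ P, ∃ y ∈ P, z = x - y) : Submodule.span ℝ (P : Set F) = ⊤ := by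
  refine Submodule.eq_top_iff'.2 fun z => ?_
  obtain ⟨x, hx, y, hy, rfl⟩ := h z
  exact Submodule.sub_mem _ (Submodule.subset_span hx) (Submodule.subset_span hy)

theorem eq_of_forall_mem_circleExp_eq {P : PointedCone ℝ F}
    (hP : Submodule.span ℝ (P : Set F) = ⊤) {B B' : F →ₗ[ℝ] F →ₗ[ℝ] ℝ}
    (h : ∀ x ∈ P, ∀ y ∈ P, Circle.exp (B x y) = Circle.exp (B' x y)) : B = B' := by
  refine LinearMap.ext_on hP fun x hx => LinearMap.ext_on hP fun y hy => ?_
  refine eq_of_forall_nonneg_circleExp_mul_eq fun t ht => ?_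
  simpa only [map_smul, LinearMap.smul_apply, smul_eq_mul] using h (t • x) (P.smul_mem ht hx) y hy

theorem IsProjectiveRep.exists_of_commutatorForm_eq {G : Type*} [NormedAddCommGroup G]
    [NormedSpace ℝ G] [FiniteDimensional ℝ G] {H : Type*} [NormedAddCommGroup H]
    [InnerProductSpace ℂ H] [CompleteSpace H] {B B' : G →ₗ[ℝ] G →ₗ[ℝ] ℝ} {V : G → 𝓤(H)}
    (hV : IsProjectiveRep (fun x y => Circle.exp (B x y)) V)
    (h : commutatorForm B = commutatorForm B') :
    ∃ c : G → Circle, IsProjectiveRep (fun x y => Circle.exp (B' x y)) fun x => c x • V x := by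
  have hcont (D : G →ₗ[ℝ] G →ₗ[ℝ] ℝ) : Continuous fun x => D x x := by
    simp only [← LinearMap.toContinuousBilinearMap_apply]
    fun_prop
  have hcomm (x y) : B x y - B y x = B' x y - B' y x := LinearMap.congr_fun₂ h x y
  refine ⟨fun x => Circle.exp ((B x x - B' x x) / 2), hV.circle_smul ?_ fun x y => ?_⟩
  · exact Circle.exp.continuous.comp (((hcont B).sub (hcont B')).div_const 2)
  · rw [← Circle.exp_add, ← Circle.exp_add, ← Circle.exp_add]
    simp only [map_add, LinearMap.add_apply]
    congr 1
    linear_combination hcomm x y / 2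

end CommutatorForm

section MatrixForm

variable {d : ℕ}

/-- The bilinear form `(x, y) ↦ ⟪M x, y⟫` of a matrix `M`, so that `ω_A = exp (i matrixForm A)`. -/
def matrixForm (M : Matrix (Fin d) (Fin d) ℝ) : E d →ₗ[ℝ] E d →ₗ[ℝ] ℝ :=
  innerₗ (E d) ∘ₗ Matrix.toEuclideanLin M

theorem coe_circleExp_matrixForm (A : StrictUpper d) (x y : E d) :
    (Circle.exp (matrixForm A.1 x y) : ℂ) = omega A x y := by
  rw [Circle.coe_exp, mul_comm]
  rfl

theorem matrixForm_single_single (M : Matrix (Fin d) (Fin d) ℝ) (i j : Fin d) :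
    matrixForm M (EuclideanSpace.single i 1) (EuclideanSpace.single j 1) = M j i := by
  simp [matrixForm, EuclideanSpace.inner_single_right]

theorem ext_single {B B' : E d →ₗ[ℝ] E d →ₗ[ℝ] ℝ}
    (h : ∀ i j, B (EuclideanSpace.single i 1) (EuclideanSpace.single j 1) =
      B' (EuclideanSpace.single i 1) (EuclideanSpace.single j 1)) : B = B' := by
  refine (EuclideanSpace.basisFun (Fin d) ℝ).toBasis.ext fun i =>
    (EuclideanSpace.basisFun (Fin d) ℝ).toBasis.ext fun j => ?_
  simpa using h i j

theorem exists_strictUpper_commutatorForm_eq (B : E d →ₗ[ℝ] E d →ₗ[ℝ] ℝ) :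
    ∃ A : StrictUpper d, commutatorForm B = commutatorForm (matrixForm A.1) := by
  set e : Fin d → E d := fun i => EuclideanSpace.single i 1
  refine ⟨⟨Matrix.of fun i j => if i < j then B (e j) (e i) - B (e i) (e j) else 0,
    fun i j hij => if_neg hij.not_gt⟩, ext_single fun i j => ?_⟩
  simp only [commutatorForm_apply, matrixForm_single_single, Matrix.of_apply]
  rcases lt_trichotomy i j with hij | rfl | hij
  · rw [if_neg hij.not_gt, if_pos hij, zero_sub, neg_sub]
  · rw [sub_self, sub_self]
  · rw [if_pos hij, if_neg hij.not_gt, sub_zero]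

theorem commutatorForm_matrixForm_injective :
    Function.Injective fun A : StrictUpper d => commutatorForm (matrixForm A.1) := by
  intro A A' h
  refine Subtype.ext (Matrix.ext fun i j => ?_)
  rcases lt_or_ge i j with hij | hij
  · have hentry := LinearMap.congr_fun₂ h (EuclideanSpace.single j 1) (EuclideanSpace.single i 1)
    simpa only [commutatorForm_apply, matrixForm_single_single, A.2 j i hij.le, A'.2 j i hij.le,
      sub_zero] using hentry
  · rw [A.2 i j hij, A'.2 i j hij]

theorem isProjectiveRep_twistedTranslation (A : StrictUpper d) :
    IsProjectiveRep (fun x y => Circle.exp (matrixForm A.1 x y)) (twistedTranslation A) where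
  strongContinuous := continuous_twistedTranslation A
  mul x y := Subtype.ext (by
    rw [coe_circle_smul, Circle.smul_def, coe_circleExp_matrixForm]
    exact twistedTranslation_mul A x y)

instance : Nontrivial (L2 d) := by
  refine ⟨indicatorConstLp 2 (measurableSet_ball (x := (0 : E d)) (ε := 1))
    measure_ball_lt_top.ne (1 : ℂ), 0, fun h => ?_⟩
  have hnorm := congrArg norm h
  rw [norm_indicatorConstLp' two_ne_zero (Metric.measure_ball_pos _ _ one_pos).ne', norm_zero,
    norm_one, one_mul] at hnorm
  refine (Real.rpow_pos_of_pos ?_ _).ne' hnorm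
  exact ENNReal.toReal_pos (Metric.measure_ball_pos _ _ one_pos).ne' measure_ball_lt_top.ne

end MatrixForm

section WeakContinuity

theorem isNormalFunctional_inner {H : Type*} [NormedAddCommGroup H] [InnerProductSpace ℂ H]
    (ξ η : H) : IsNormalFunctional fun T : H →L[ℂ] H => ⟪ξ, T η⟫_ℂ := by
  have hsum (ζ : H) : Summable fun n => ‖Pi.single (M := fun _ : ℕ => H) 0 ζ n‖ ^ 2 :=
    summable_of_ne_finset_zero (s := {0}) fun n hn => by
      rw [Pi.single_eq_of_ne (Finset.notMem_singleton.1 hn), norm_zero, zero_pow two_ne_zero]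
  refine ⟨Pi.single 0 ξ, Pi.single 0 η, hsum ξ, hsum η, fun T => ?_⟩
  rw [tsum_eq_single 0 fun n hn => by rw [Pi.single_eq_of_ne hn, inner_zero_left]]
  simp only [Pi.single_eq_same]

variable {H : Type*} [NormedAddCommGroup H] [InnerProductSpace ℂ H] [CompleteSpace H]

theorem WeakContinuous.mul_left {X : Type*} [TopologicalSpace X] {β : X → Aut(H)}
    (hβ : WeakContinuous β) (g : Aut(H)) : WeakContinuous fun x => g * β x := by
  obtain ⟨u, rfl⟩ := exists_unitary_conjStarAlgAut_eq g
  intro T ξ η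
  refine (hβ T (star (u : H →L[ℂ] H) ξ) (star (u : H →L[ℂ] H) η)).congr fun x => ?_
  rw [StarAlgEquiv.mul_apply, Unitary.conjStarAlgAut_apply, ContinuousLinearMap.star_eq_adjoint,
    ContinuousLinearMap.adjoint_inner_left]
  rfl

theorem weakContinuous_of_nonneg {γ : AddChar ℝ Aut(H)}
    (hγ : WeakContinuous fun t : ℝ => γ (max t 0)) : WeakContinuous γ := by
  refine fun T ξ η => continuous_iff_continuousAt.2 fun t₀ => ?_
  have hcont : Continuous fun t => ⟪ξ, (γ (t₀ - 1) * γ (max (t - (t₀ - 1)) 0)) T η⟫_ℂ :=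
    (hγ.mul_left (γ (t₀ - 1)) T ξ η).comp (continuous_sub_right (t₀ - 1))
  refine hcont.continuousAt.congr ?_
  filter_upwards [lt_mem_nhds (sub_one_lt t₀)] with t ht
  rw [max_eq_left (sub_nonneg.2 ht.le), ← γ.map_add_eq_mul, add_sub_cancel]

end WeakContinuity

section Classification

variable {d : ℕ} {P : PointedCone ℝ (E d)}
variable {H : Type*} [NormedAddCommGroup H] [InnerProductSpace ℂ H] [CompleteSpace H]

theorem ExtendsToAutGroup.exists_addChar {α : E0Semigroup P H} (h : ExtendsToAutGroup α) :
    ∃ β : AddChar (E d) Aut(H), ∀ (x : P) T, α.toFun x T = β x T := by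
  obtain ⟨β, β_zero, β_add, hβ⟩ := h
  exact ⟨⟨β, StarAlgEquiv.ext β_zero, fun x y => StarAlgEquiv.ext (β_add x y)⟩, hβ⟩

theorem weakContinuous_line_of_mem {α : E0Semigroup P H} {β : AddChar (E d) Aut(H)}
    (hβ : ∀ (x : P) T, α.toFun x T = β x T) {e : E d} (he : e ∈ P) :
    WeakContinuous fun t : ℝ => β (t • e) := by
  refine weakContinuous_of_nonneg
    (γ := β.compAddMonoidHom (LinearMap.toSpanSingleton ℝ (E d) e).toAddMonoidHom)
    fun T ξ η => ?_
  let ray : ℝ → P := fun t => ⟨max t 0 • e, P.smul_mem (le_max_right t 0) he⟩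
  have ray_cont : Continuous ray := Continuous.subtype_mk (by fun_prop) _
  refine ((α.continuous' _ (isNormalFunctional_inner ξ η) T).comp ray_cont).congr fun t => ?_
  rw [Function.comp_apply, hβ]
  rfl

theorem exists_strictUpper_isProjectiveRep [Nontrivial H]
    (hP : Submodule.span ℝ (P : Set (E d)) = ⊤) {α : E0Semigroup P H}
    (hα : ExtendsToAutGroup α) :
    ∃ (A : StrictUpper d) (V : P → 𝓤(H)),
      IsProjectiveRep (fun x y : P => Circle.exp (matrixForm A.1 x y)) V ∧ Implements V α := by
  obtain ⟨β, hβ⟩ := hα.exists_addChar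
  have := Module.Finite.finite_basis (Module.Basis.ofSpan hP.ge)
  obtain ⟨B, V, hV, hVβ⟩ := exists_bilinear_isProjectiveRep (Module.Basis.ofSpan hP.ge) fun i =>
    weakContinuous_line_of_mem hβ (Module.Basis.ofSpan_subset hP.ge ⟨i, rfl⟩)
  obtain ⟨A, hA⟩ := exists_strictUpper_commutatorForm_eq B
  obtain ⟨c, hc⟩ := hV.exists_of_commutatorForm_eq hA
  refine ⟨A, _, hc.comp P.subtype.toAddMonoidHom continuous_subtype_val, fun x T => ?_⟩
  rw [conjStarAlgAut_circle_smul, hVβ]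
  exact hβ x T

theorem isProjectiveRep_twistedTranslation_cone (P : PointedCone ℝ (E d)) (A : StrictUpper d) :
    IsProjectiveRep (fun x y : P => Circle.exp (matrixForm A.1 x y))
      fun x : P => twistedTranslation A x :=
  (isProjectiveRep_twistedTranslation A).comp P.subtype.toAddMonoidHom continuous_subtype_val

theorem implements_twistedE0 (P : PointedCone ℝ (E d)) (A : StrictUpper d) :
    Implements (fun x : P => twistedTranslation A x) (twistedE0 P A) :=
  fun _ _ => rfl

theorem eq_of_cocycleConjugate_twistedE0 (hP : Submodule.span ℝ (P : Set (E d)) = ⊤)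
    {A A' : StrictUpper d} (h : CocycleConjugate (twistedE0 P A) (twistedE0 P A')) : A = A' := by
  obtain ⟨V, hV, hVα⟩ := h.exists_isProjectiveRep (isProjectiveRep_twistedTranslation_cone P A')
    (implements_twistedE0 P A')
  have hA := isProjectiveRep_twistedTranslation_cone P A
  have hcomm := hA.multiplier_mul_comm_of_conjStarAlgAut_eq hV
    fun x => StarAlgEquiv.ext fun T => hVα x T
  refine commutatorForm_matrixForm_injective (eq_of_forall_mem_circleExp_eq hP fun x hx y hy => ?_)
  rw [commutatorForm_apply, commutatorForm_apply, Circle.exp_sub, Circle.exp_sub,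
    div_eq_div_iff_mul_eq_mul, hcomm ⟨x, hx⟩ ⟨y, hy⟩, mul_comm]

theorem exists_cocycleConjugate_twistedE0 (hP : Submodule.span ℝ (P : Set (E d)) = ⊤)
    {α : E0Semigroup P (L2 d)} (hα : ExtendsToAutGroup α) :
    ∃ A, CocycleConjugate (twistedE0 P A) α := by
  obtain ⟨A, V, hV, hVα⟩ := exists_strictUpper_isProjectiveRep hP hα
  exact ⟨A, cocycleConjugate_of_isProjectiveRep (LinearIsometryEquiv.refl ℂ (L2 d))
    (isProjectiveRep_twistedTranslation_cone P A) (implements_twistedE0 P A) hV hVα⟩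

end Classification

end ConeE0

end

theorem mainTheorem12_general (d : ℕ) (P : PointedCone ℝ (ConeE0.E d))
    (hP : Submodule.span ℝ (P : Set (ConeE0.E d)) = ⊤) :
    Function.Bijective fun A : ConeE0.StrictUpper d => ConeE0.twistedClass P A := by
  refine ⟨fun A A' h => ConeE0.eq_of_cocycleConjugate_twistedE0 hP (Quotient.exact h), fun c => ?_⟩
  induction c using Quotient.inductionOn with
  | h α =>
    obtain ⟨A, hA⟩ := ConeE0.exists_cocycleConjugate_twistedE0 hP α.2
    exact ⟨A, Quotient.sound hA⟩

theorem mainTheorem12 (d : ℕ) (P : PointedCone ℝ (EuclideanSpace ℝ (Fin d)))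
    (hclosed : IsClosed (P : Set (EuclideanSpace ℝ (Fin d))))
    (hspanning : ∀ z : EuclideanSpace ℝ (Fin d), ∃ x ∈ P, ∃ y ∈ P, z = x - y)
    (hpointed : ∀ x : EuclideanSpace ℝ (Fin d), x ∈ P → -x ∈ P → x = 0) :
    Function.Bijective
      (fun A : ConeE0.StrictUpper d => ConeE0.twistedClass P A) :=
  mainTheorem12_general d P (ConeE0.span_eq_top_of_forall_exists_sub hspanning)
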